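/- Let $P\in\mathbb R^3$, $m_+,m_->0$, and set $M=m_++m_-$, $\mu_\pm=m_\pm/M$, $\widetilde\mu=(\mu_--\mu_+)/2$, $g=\sqrt{|P|^2+M^2}$. Define the kinetic energy symbol $$T(\eta)=\sqrt{|\mu_+P-\eta|^2+\mu_+^2M^2}+\sqrt{|\mu_-P+\eta|^2+\mu_-^2M^2}-\sqrt{|P|^2+M^2},\qquad \eta\in\mathbb R^3,$$ and let $T(q)$, $q=-i\nabla$, be the corresponding Fourier multiplier on $L^2(\mathbb R^3)$. Let $V:\mathbb R^3\to\mathbb R$ be a measurable potential which is relatively form compact with respect to $T(q)$, i.e. $(T(q)+1)^{-1/2}|V|(T(q)+1)^{-1/2}$ (understood through its sesquilinear form) is a compact operator on $L^2(\mathbb R^3)$. Let $H_{\mathrm{rel}}(P)=T(q)+V$ be the relativistic pair operator, defined as a sum of quadratic forms on the form domain of $T(q)$, and let $N(H_{\mathrm{rel}}(P))$ be the number of its strictly negative eigenvalues, counted with multiplicity. Write $V_-=\max(0,-V)$, let $|B_1^3|$ be the volume of the unit ball of $\mathbb R^3$, and for $u\ge 0$ put $$G^3(u)=\frac{3|B_1^3|}{(4\pi)^3}\,\frac{u^{3/2}(u+g)(u+2g)^{3/2}}{(u^2+2ug+M^2)^{1/2}}\left(\frac{u^2+2ug+(1-4\widetilde\mu^2)M^2}{u^2+2ug+M^2}\right)^{3/2},$$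 $$G^{\mathrm{mod}}(u)=G^3(u)+u\,\frac{|B_1^3|}{2^{1/2}(2\pi)^3}\,(|P|^2+M^2)\,\ln\!\left(\sqrt{1+|P|^2/M^2}+\sqrt{2+|P|^2/M^2}\right).$$ Then for every $0<\alpha<\tfrac14$, $$N(H_{\mathrm{rel}}(P))\le\frac{\alpha^2}{(1-4\alpha)^2}\int_{\mathbb R^3}G^{\mathrm{mod}}\big(\alpha^{-2}V_-(x)\big)\,dx ,$$ where the right-hand side may be $+\infty$. -/

import Mathlib

open MeasureTheory
open scoped ENNReal FourierTransform ComplexConjugate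

noncomputable section

namespace PairOperator

/-- Position space (and momentum space) `ℝ^d` with the Euclidean norm. -/
abbrev Space (d : ℕ) : Type := EuclideanSpace ℝ (Fin d)

/-- The Hilbert space `L²(ℝ^d)` of complex-valued functions. -/
abbrev HSpace (d : ℕ) : Type := Lp (α := Space d) ℂ 2 volume

variable {d : ℕ}

/-! ## Fourier multipliers

Mathlib's Fourier transform is `𝓕 f ξ = ∫ exp (-2 π i ⟨x, ξ⟩) f x dx`, so that `p = -i∇` acts on the
Fourier side as multiplication by `2 π ξ`, and the operator `b(p)` as multiplication by
`b (2 π ξ)`. -/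

/-- The natural (maximal) domain of the Fourier multiplier `b(p)` on `L²(ℝ^d)`. -/
def multiplierDomain (b : Space d → ℝ) : Submodule ℂ (HSpace d) where
  carrier := {f | MemLp (fun ξ => (b ((2 * Real.pi) • ξ) : ℂ) * (𝓕 f : HSpace d) ξ) 2 volume}
  zero_mem' := by
    have h0 : (𝓕 (0 : HSpace d) : HSpace d) = 0 := (Lp.fourierTransformₗᵢ (Space d) ℂ).map_zero
    refine (MemLp.zero' (p := 2) (μ := (volume : Measure (Space d))) (ε := ℂ)).ae_eq ?_
    rw [h0]
    filter_upwards [Lp.coeFn_zero ℂ 2 (volume : Measure (Space d))] with ξ hξ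
    simp
  add_mem' := by
    intro f g hf hg
    refine (hf.add hg).ae_eq ?_
    rw [FourierTransform.fourier_add]
    filter_upwards [Lp.coeFn_add (𝓕 f : HSpace d) (𝓕 g : HSpace d)] with ξ hξ
    rw [hξ, Pi.add_apply, Pi.add_apply, mul_add]
  smul_mem' := by
    intro c f hf
    refine (hf.const_smul c).ae_eq ?_
    rw [FourierTransform.fourier_smul]
    filter_upwards [Lp.coeFn_smul c (𝓕 f : HSpace d)] with ξ hξ
    rw [hξ, Pi.smul_apply, Pi.smul_apply, smul_eq_mul, smul_eq_mul, mul_left_comm]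

theorem mem_multiplierDomain {b : Space d → ℝ} {f : HSpace d} : f ∈ multiplierDomain b ↔
    MemLp (fun ξ => (b ((2 * Real.pi) • ξ) : ℂ) * (𝓕 f : HSpace d) ξ) 2 volume := Iff.rfl

/-- The Fourier multiplier `b(p) f = 𝓕⁻¹ (b(2π ·) 𝓕 f)`, `p = -i∇`, on its natural domain. -/
def fourierMultiplier (b : Space d → ℝ) : HSpace d →ₗ.[ℂ] HSpace d where
  domain := multiplierDomain b
  toFun :=
    { toFun := fun f => 𝓕⁻ (MemLp.toLp _ (mem_multiplierDomain.mp f.2) : HSpace d)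
      map_add' := by
        intro f g
        rw [← FourierTransform.fourierInv_add, ← MemLp.toLp_add]
        congr 1
        apply MemLp.toLp_congr
        rw [Submodule.coe_add, FourierTransform.fourier_add]
        filter_upwards [Lp.coeFn_add (𝓕 (f : HSpace d) : HSpace d) (𝓕 (g : HSpace d) : HSpace d)]
          with ξ hξ
        rw [hξ, Pi.add_apply, Pi.add_apply, mul_add]
      map_smul' := by
        intro c f
        rw [RingHom.id_apply, ← FourierTransform.fourierInv_smul, ← MemLp.toLp_const_smul]
        congr 1
        apply MemLp.toLp_congr
        rw [Submodule.coe_smul, FourierTransform.fourier_smul]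
        filter_upwards [Lp.coeFn_smul c (𝓕 (f : HSpace d) : HSpace d)] with ξ hξ
        rw [hξ, Pi.smul_apply, Pi.smul_apply, smul_eq_mul, smul_eq_mul, mul_left_comm] }

/-- A Fourier multiplier with measurable symbol is densely defined: only `0` is orthogonal to its
domain. -/
theorem eq_zero_of_orthogonal_domain {b : Space d → ℝ} (hb : Measurable b) (f : HSpace d)
    (hf : ∀ φ ∈ multiplierDomain b, inner ℂ φ f = 0) : f = 0 := by
  set F : HSpace d := 𝓕 f with hF
  suffices hF0 : F = 0 by
    have h := Lp.norm_fourier_eq f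
    rw [← hF, hF0, norm_zero] at h
    exact norm_eq_zero.mp h.symm
  have hF2 : MemLp F 2 volume := Lp.memLp F
  have key : ∀ n : ℕ, ∀ᵐ ξ ∂(volume : Measure (Space d)),
      |b ((2 * Real.pi) • ξ)| ≤ n → F ξ = 0 := by
    intro n
    set S : Set (Space d) := {ξ | |b ((2 * Real.pi) • ξ)| ≤ n} with hS
    have hb' : Measurable fun ξ : Space d => b ((2 * Real.pi) • ξ) :=
      hb.comp (measurable_const_smul _)
    have hSm : MeasurableSet S := measurableSet_le (by fun_prop) measurable_const
    have hG : MemLp (S.indicator F) 2 volume := hF2.indicator hSm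
    set G : HSpace d := hG.toLp _ with hGdef
    have hGae : G =ᵐ[volume] S.indicator F := hG.coeFn_toLp
    have hmem : (𝓕⁻ G : HSpace d) ∈ multiplierDomain b := by
      change MemLp _ 2 volume
      rw [FourierTransform.fourier_fourierInv_eq]
      refine MemLp.of_le_mul (c := n) (Lp.memLp G) ?_ ?_
      · exact ((Complex.measurable_ofReal.comp hb').aestronglyMeasurable).mul
          (Lp.aestronglyMeasurable G)
      · filter_upwards [hGae] with ξ hξ
        rw [norm_mul, Complex.norm_real, Real.norm_eq_abs]
        by_cases h : ξ ∈ S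
        · exact mul_le_mul_of_nonneg_right h (norm_nonneg _)
        · rw [hξ, Set.indicator_of_notMem h]
          simp
    have h0 : inner ℂ G F = 0 := by
      have h := hf _ hmem
      rw [← Lp.inner_fourier_eq, FourierTransform.fourier_fourierInv_eq] at h
      exact h
    have h1 : inner ℂ G G = (0 : ℂ) := by
      rw [← h0, L2.inner_def, L2.inner_def]
      apply integral_congr_ae
      filter_upwards [hGae] with ξ hξ
      rw [hξ]
      by_cases h : ξ ∈ S
      · rw [Set.indicator_of_mem h]
      · rw [Set.indicator_of_notMem h, inner_zero_left, inner_zero_left]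
    have hG0 : G = 0 := inner_self_eq_zero.mp h1
    rw [hG0] at hGae
    filter_upwards [hGae, Lp.coeFn_zero ℂ 2 (volume : Measure (Space d))] with ξ h2 h3 h4
    rw [h3, Set.indicator_of_mem (show ξ ∈ S from h4)] at h2
    exact h2.symm
  rw [Lp.eq_zero_iff_ae_eq_zero]
  filter_upwards [ae_all_iff.mpr key] with ξ hξ
  obtain ⟨n, hn⟩ := exists_nat_ge |b ((2 * Real.pi) • ξ)|
  exact hξ n hn

/-- A Fourier multiplier with bounded measurable symbol is defined on all of `L²(ℝ^d)`. -/
theorem multiplierDomain_eq_top {b : Space d → ℝ} (hb : Measurable b) {c : ℝ}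
    (hc : ∀ η, |b η| ≤ c) : multiplierDomain b = ⊤ := by
  refine eq_top_iff.mpr fun f _ => ?_
  have hb' : Measurable fun ξ : Space d => b ((2 * Real.pi) • ξ) :=
    hb.comp (measurable_const_smul _)
  change MemLp _ 2 volume
  refine MemLp.of_le_mul (c := c) (Lp.memLp (𝓕 f : HSpace d)) ?_ ?_
  · exact ((Complex.measurable_ofReal.comp hb').aestronglyMeasurable).mul
      (Lp.aestronglyMeasurable (𝓕 f : HSpace d))
  · filter_upwards with ξ
    rw [norm_mul, Complex.norm_real, Real.norm_eq_abs]
    exact mul_le_mul_of_nonneg_right (hc _) (norm_nonneg _)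

/-! ## The operator `T(p) + V` -/

/-- The form domain `Q(T(p))`, that is the domain of `√T(p)`. -/
abbrev formDomain (T : Space d → ℝ) : Submodule ℂ (HSpace d) :=
  (fourierMultiplier fun η => √(T η)).domain

/-- The sesquilinear form of `T(p)` on its form domain, `⟨√T(p) φ, √T(p) ψ⟩`. -/
def kineticForm (T : Space d → ℝ) (φ ψ : formDomain T) : ℂ :=
  inner ℂ (fourierMultiplier (fun η => √(T η)) φ) (fourierMultiplier (fun η => √(T η)) ψ)

theorem kineticForm_zero (T : Space d → ℝ) (φ : formDomain T) : kineticForm T φ 0 = 0 := by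
  rw [kineticForm, LinearPMap.map_zero, inner_zero_right]

theorem kineticForm_add (T : Space d → ℝ) (φ ψ₁ ψ₂ : formDomain T) :
    kineticForm T φ (ψ₁ + ψ₂) = kineticForm T φ ψ₁ + kineticForm T φ ψ₂ := by
  rw [kineticForm, LinearPMap.map_add, inner_add_right]
  rfl

theorem kineticForm_smul (T : Space d → ℝ) (φ : formDomain T) (c : ℂ) (ψ : formDomain T) :
    kineticForm T φ (c • ψ) = c * kineticForm T φ ψ := by
  rw [kineticForm, LinearPMap.map_smul, inner_smul_right]
  rfl

/-- The sesquilinear form of the potential, `∫ V φ̄ ψ`. -/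
def potentialForm (V : Space d → ℝ) (φ ψ : HSpace d) : ℂ :=
  ∫ x, (V x : ℂ) * (conj (φ x) * ψ x)

/-- The potential `V` is relatively form compact with respect to `T(p)`: the operator
`(T(p)+1)^{-1/2} |V| (T(p)+1)^{-1/2}` (the one with this sesquilinear form) is a compact operator
on `L²(ℝ^d)`. -/
def RelativelyFormCompact (T V : Space d → ℝ) : Prop :=
  let R := fourierMultiplier fun η => (√(T η + 1))⁻¹
  ∃ K : HSpace d →L[ℂ] HSpace d, IsCompactOperator K ∧
    ∀ φ ψ : R.domain,
      Integrable (fun x => ((|V x| : ℝ) : ℂ) * (conj ((R φ) x) * (R ψ) x)) volume ∧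
      inner ℂ (φ : HSpace d) (K ψ) = potentialForm (fun x => |V x|) (R φ) (R ψ)

/-- The graph of the operator associated with the quadratic form of `T(p) + V` on `Q(T(p))`: the
pairs `(ψ, f)` with `ψ ∈ Q(T(p))` and `⟨√T(p) φ, √T(p) ψ⟩ + ∫ V φ̄ ψ = ⟨φ, f⟩` for all
`φ ∈ Q(T(p))`. -/
def formSumGraph (T V : Space d → ℝ) : Submodule ℂ (HSpace d × HSpace d) where
  carrier := {z | ∃ hz : z.1 ∈ formDomain T, ∀ φ : formDomain T,
    Integrable (fun x => (V x : ℂ) * (conj ((φ : HSpace d) x) * z.1 x)) volume ∧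
    kineticForm T φ ⟨z.1, hz⟩ + potentialForm V φ z.1 = inner ℂ (φ : HSpace d) z.2}
  zero_mem' := by
    refine ⟨Submodule.zero_mem _, fun φ => ?_⟩
    have h : (fun x => (V x : ℂ) * (conj ((φ : HSpace d) x) * (0 : HSpace d) x))
        =ᵐ[volume] fun _ => 0 := by
      filter_upwards [Lp.coeFn_zero ℂ 2 (volume : Measure (Space d))] with x hx
      simp
    refine ⟨(integrable_zero _ _ _).congr h.symm, ?_⟩
    have h1 : potentialForm V (φ : HSpace d) 0 = 0 := by
      rw [potentialForm, integral_congr_ae h, integral_zero]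
    have h2 : kineticForm T φ ⟨0, Submodule.zero_mem _⟩ = 0 := kineticForm_zero T φ
    change kineticForm T φ ⟨0, Submodule.zero_mem _⟩ + potentialForm V (φ : HSpace d) 0
      = inner ℂ (φ : HSpace d) 0
    rw [h1, h2, inner_zero_right, add_zero]
  add_mem' := by
    rintro ⟨ψ₁, f₁⟩ ⟨ψ₂, f₂⟩ ⟨h₁, H₁⟩ ⟨h₂, H₂⟩
    refine ⟨Submodule.add_mem _ h₁ h₂, fun φ => ?_⟩
    have h : (fun x => (V x : ℂ) * (conj ((φ : HSpace d) x) * (ψ₁ + ψ₂ : HSpace d) x))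
        =ᵐ[volume] fun x => (V x : ℂ) * (conj ((φ : HSpace d) x) * ψ₁ x) +
          (V x : ℂ) * (conj ((φ : HSpace d) x) * ψ₂ x) := by
      filter_upwards [Lp.coeFn_add ψ₁ ψ₂] with x hx
      rw [hx, Pi.add_apply, mul_add, mul_add]
    refine ⟨((H₁ φ).1.add (H₂ φ).1).congr h.symm, ?_⟩
    have e1 : potentialForm V (φ : HSpace d) (ψ₁ + ψ₂)
        = potentialForm V (φ : HSpace d) ψ₁ + potentialForm V (φ : HSpace d) ψ₂ := by
      rw [potentialForm, integral_congr_ae h, integral_add (H₁ φ).1 (H₂ φ).1]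
      rfl
    have e2 : kineticForm T φ ⟨ψ₁ + ψ₂, Submodule.add_mem _ h₁ h₂⟩
        = kineticForm T φ ⟨ψ₁, h₁⟩ + kineticForm T φ ⟨ψ₂, h₂⟩  :=
      kineticForm_add T φ ⟨ψ₁, h₁⟩ ⟨ψ₂, h₂⟩
    have a1 := (H₁ φ).2
    have a2 := (H₂ φ).2
    change kineticForm T φ ⟨ψ₁ + ψ₂, Submodule.add_mem _ h₁ h₂⟩
      + potentialForm V (φ : HSpace d) (ψ₁ + ψ₂) = inner ℂ (φ : HSpace d) (f₁ + f₂)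
    rw [e1, e2, inner_add_right, ← a1, ← a2]
    ring
  smul_mem' := by
    rintro c ⟨ψ, f⟩ ⟨h₁, H₁⟩
    refine ⟨Submodule.smul_mem _ c h₁, fun φ => ?_⟩
    have h : (fun x => (V x : ℂ) * (conj ((φ : HSpace d) x) * (c • ψ : HSpace d) x))
        =ᵐ[volume] fun x => c * ((V x : ℂ) * (conj ((φ : HSpace d) x) * ψ x)) := by
      filter_upwards [Lp.coeFn_smul c ψ] with x hx
      rw [hx, Pi.smul_apply, smul_eq_mul]
      ring
    refine ⟨((H₁ φ).1.const_mul c).congr h.symm, ?_⟩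
    have e1 : potentialForm V (φ : HSpace d) (c • ψ) = c * potentialForm V (φ : HSpace d) ψ := by
      rw [potentialForm, integral_congr_ae h, integral_const_mul]
      rfl
    have e2 : kineticForm T φ ⟨c • ψ, Submodule.smul_mem _ c h₁⟩
        = c * kineticForm T φ ⟨ψ, h₁⟩ :=
      kineticForm_smul T φ c ⟨ψ, h₁⟩
    have a1 := (H₁ φ).2
    change kineticForm T φ ⟨c • ψ, Submodule.smul_mem _ c h₁⟩
      + potentialForm V (φ : HSpace d) (c • ψ) = inner ℂ (φ : HSpace d) (c • f)
    rw [e1, e2, inner_smul_right, ← a1]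
    ring

/-- The operator `T(p) + V` on `L²(ℝ^d)`, defined as a form sum on `Q(T(p))`. -/
def schrodinger (T V : Space d → ℝ) : HSpace d →ₗ.[ℂ] HSpace d :=
  (formSumGraph T V).toLinearPMap

/-- For a measurable symbol the operator `T(p) + V` is well defined: `formSumGraph` is the graph
of an operator. -/
theorem schrodinger_graph {T : Space d → ℝ} (hT : Measurable T) (V : Space d → ℝ) :
    (schrodinger T V).graph = formSumGraph T V := by
  apply Submodule.toLinearPMap_graph_eq
  rintro ⟨ψ, f⟩ ⟨hψ, H⟩ h0
  obtain rfl : ψ = 0 := h0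
  refine eq_zero_of_orthogonal_domain (b := fun η => √(T η)) hT.sqrt f fun φ hφ => ?_
  have h2 : kineticForm T ⟨φ, hφ⟩ ⟨0, hψ⟩ = 0 := kineticForm_zero T ⟨φ, hφ⟩
  have h1 : potentialForm V φ 0 = 0 := by
    rw [potentialForm, ← integral_zero (Space d) ℂ (μ := volume)]
    apply integral_congr_ae
    filter_upwards [Lp.coeFn_zero ℂ 2 (volume : Measure (Space d))] with x hx
    simp
  have := (H ⟨φ, hφ⟩).2
  change kineticForm T ⟨φ, hφ⟩ ⟨0, hψ⟩ + potentialForm V φ 0 = inner ℂ φ f at this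
  rw [← this, h1, h2, add_zero]

/-! ## Counting negative eigenvalues -/

/-- The eigenspace `{ψ ∈ D(A) : A ψ = z ψ}` of an operator `A`. -/
def eigenspace (A : HSpace d →ₗ.[ℂ] HSpace d) (z : ℂ) : Submodule ℂ (HSpace d) where
  carrier := {ψ | ∃ h : ψ ∈ A.domain, A ⟨ψ, h⟩ = z • ψ}
  zero_mem' := ⟨Submodule.zero_mem _, by
    rw [smul_zero]; exact LinearPMap.map_zero A⟩
  add_mem' := by
    rintro ψ₁ ψ₂ ⟨h₁, e₁⟩ ⟨h₂, e₂⟩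
    refine ⟨Submodule.add_mem _ h₁ h₂, ?_⟩
    rw [smul_add, ← e₁, ← e₂]
    exact LinearPMap.map_add A ⟨ψ₁, h₁⟩ ⟨ψ₂, h₂⟩
  smul_mem' := by
    rintro c ψ ⟨h, e⟩
    refine ⟨Submodule.smul_mem _ c h, ?_⟩
    rw [smul_comm, ← e]
    exact LinearPMap.map_smul A c ⟨ψ, h⟩

/-- The number `N(A)` of strictly negative eigenvalues of `A`, counted with multiplicity: the sum
of `dim ker (A - E)` over all `E < 0`, with values in `[0, ∞]`. -/
def numNegEigenvalues (A : HSpace d →ₗ.[ℂ] HSpace d) : ℝ≥0∞ :=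
  ∑' E : Set.Iio (0 : ℝ),
    ((Cardinal.toENat (Module.rank ℂ (eigenspace A ((E : ℝ) : ℂ))) : ℕ∞) : ℝ≥0∞)

/-! ## The relativistic pair operator -/

/-- The kinetic energy symbol of the relativistic pair operator with total momentum `P` and masses
`m₊ = mp`, `m₋ = mm`, where `M = m₊ + m₋` and `μ± = m± / M`. -/
def pairSymbol (P : Space d) (mp mm : ℝ) (η : Space d) : ℝ :=
  let M := mp + mm
  let μp := mp / M
  let μm := mm / M
  √(‖μp • P - η‖ ^ 2 + μp ^ 2 * M ^ 2) + √(‖μm • P + η‖ ^ 2 + μm ^ 2 * M ^ 2)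
    - √(‖P‖ ^ 2 + M ^ 2)

theorem measurable_pairSymbol (P : Space d) (mp mm : ℝ) : Measurable (pairSymbol P mp mm) := by
  unfold pairSymbol
  fun_prop

/-- The kinetic energy is nonnegative, by Minkowski's inequality in `ℝ^d × ℝ`. -/
theorem pairSymbol_nonneg (P : Space d) {mp mm : ℝ} (hmp : 0 < mp) (hmm : 0 < mm) (η : Space d) :
    0 ≤ pairSymbol P mp mm η := by
  have hM : mp + mm ≠ 0 := by positivity
  have hsum : mp / (mp + mm) + mm / (mp + mm) = 1 := by field_simp
  have e1 : mp / (mp + mm) * (mp + mm) = mp := by field_simp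
  have e2 : mm / (mp + mm) * (mp + mm) = mm := by field_simp
  have hP : P = (mp / (mp + mm)) • P - η + ((mm / (mp + mm)) • P + η) := by
    rw [sub_add_add_cancel, ← add_smul, hsum, one_smul]
  have key : ∀ x y : Space d, √(‖x + y‖ ^ 2 + (mp + mm) ^ 2)
      ≤ √(‖x‖ ^ 2 + mp ^ 2) + √(‖y‖ ^ 2 + mm ^ 2) := by
    intro x y
    have h := norm_add_le (WithLp.toLp 2 (x, mp) : WithLp 2 (Space d × ℝ)) (WithLp.toLp 2 (y, mm))
    simpa [WithLp.prod_norm_eq_of_L2] using h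
  have h := key ((mp / (mp + mm)) • P - η) ((mm / (mp + mm)) • P + η)
  rw [← hP] at h
  simp only [pairSymbol, ← mul_pow, e1, e2]
  linarith

/-- The relativistic pair operator `H_rel(P) = T_{P,M,μ±}(q) + V` on `L²(ℝ^d)`. -/
def pairOperator (P : Space d) (mp mm : ℝ) (V : Space d → ℝ) : HSpace d →ₗ.[ℂ] HSpace d :=
  schrodinger (pairSymbol P mp mm) V

/-- The volume `|B₁^d|` of the unit ball of `ℝ^d`. -/
def unitBallVolume (d : ℕ) : ℝ := volume.real (Metric.ball (0 : Space d) 1)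

/-- The function `G^d_{P,M,μ̃}(u)`. -/
def semiclassicalG (P : Space d) (M μt u : ℝ) : ℝ :=
  let g := √(‖P‖ ^ 2 + M ^ 2)
  let D := u ^ 2 + 2 * u * g + M ^ 2
  3 * unitBallVolume d / (4 * Real.pi) ^ d
    * (u ^ ((d : ℝ) / 2) * (u + g) * (u + 2 * g) ^ ((d : ℝ) / 2) / √D)
    * ((u ^ 2 + 2 * u * g + (1 - 4 * μt ^ 2) * M ^ 2) / D) ^ ((d : ℝ) / 2)

/-- The function `G^mod_{P,M,μ̃}(u)` in dimension three. -/
def modifiedG (P : Space 3) (M μt u : ℝ) : ℝ :=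
  semiclassicalG P M μt u
    + u * (unitBallVolume 3 / (√2 * (2 * Real.pi) ^ 3)) * (‖P‖ ^ 2 + M ^ 2)
      * Real.log (√(1 + ‖P‖ ^ 2 / M ^ 2) + √(2 + ‖P‖ ^ 2 / M ^ 2))

end PairOperator

end

noncomputable section

namespace PairOperator

variable {d : ℕ}

/-! ## The Fourier transform on `L¹ ∩ L²` and Bessel's inequality -/

/-! The proof joins a Cwikel-type estimate to an explicit computation of the sublevel volumes of the
symbol. Write `T` for the symbol and `w` for the negative part of `V`.

On the span of finitely many eigenvectors with nonpositive eigenvalues the form of `T(q) + V` is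
nonpositive. Choosing there a basis orthonormal for the kinetic form gives vectors `ψ` with `∫ w
|ψ|² ≥ 1`, while the `F = √T 𝓕ψ` are orthonormal (`exists_orthonormal_kinetic`). It remains to bound
the size `N` of such a family.

Cwikel's argument (`card_le_phaseSpace`) cuts position space into shells `4^n < w/α² ≤ 4^(n+1)` and,
on shell `n`, cuts momentum space at `T = 4^n`. High momenta contribute to each `∫ w |ψ|²` at most
`16 α²`, by Plancherel and a geometric series. Low momenta are controlled for the whole family at
once by Bessel's inequality, which gives in total at most `X = ∫ w(x) ∫_{T < w(x)/α²} 1/T dξ dx`.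
Combining the two with weights `1/(4α)` and `1/(1-4α)` yields `N ≤ 4αN + X/(1-4α)`, that is `N ≤
X/(1-4α)²`.

For the inner integral, Lorentz invariance is decisive: in centre-of-mass variables a sublevel set
of the two-body energy is a ball, so in the original variables it lies in an ellipsoid of explicit
volume (`volume_pairSymbol_lt_le`). The layer cake formula turns `∫ 1/T` into a boundary term plus a
one-dimensional integral of these volumes. A derivative comparison
(`volumeFactor_div_sqrt_le_deriv`) bounds the latter, and the sum is the semiclassical term plus the
logarithm in `modifiedG`. -/

theorem continuous_fourierInv {f : Space d → ℂ} (hf : Integrable f) : Continuous (𝓕⁻ f) := by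
  have h := VectorFourier.fourierIntegral_continuous (e := Real.fourierChar) (μ := volume)
    (L := -innerₗ (Space d)) (f := f) Real.continuous_fourierChar
    (continuous_inner (𝕜 := ℝ) (E := Space d)).neg hf
  exact h

theorem integral_fourierInv_smul_eq {f g : Space d → ℂ} (hf : Integrable f) (hg : Integrable g) :
    ∫ x, 𝓕⁻ f x • g x = ∫ x, f x • 𝓕⁻ g x := by
  have h := VectorFourier.integral_fourierIntegral_smul_eq_flip (e := Real.fourierChar)
    (μ := volume) (ν := volume) (L := -innerₗ (Space d)) (f := f) (g := g)
    Real.continuous_fourierChar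
    (continuous_inner (𝕜 := ℝ) (E := Space d)).neg hf hg
  have hflip : (-innerₗ (Space d)).flip = -innerₗ (Space d) := by
    ext x y
    simp [real_inner_comm]
  rw [hflip] at h
  exact h

/-- On `L¹ ∩ L²` the inverse Fourier transform is given by the inverse Fourier integral. -/
theorem fourierInv_coeFn_ae (f : HSpace d) (hf : Integrable f) :
    (𝓕⁻ f : HSpace d) =ᵐ[volume] 𝓕⁻ (f : Space d → ℂ) := by
  -- The `L²` transform is the distributional one, and self-adjointness of the Fourier integral
  -- moves it onto the test function; so both sides have the same integrals against smooth compactly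
  -- supported functions.
  apply ae_eq_of_integral_contDiff_smul_eq
  · exact (Lp.memLp (𝓕⁻ f : HSpace d)).locallyIntegrable (by norm_num)
  · exact (continuous_fourierInv hf).locallyIntegrable
  intro g g_smooth g_cpt
  have hg₁ : HasCompactSupport (Complex.ofRealCLM ∘ g) := g_cpt.comp_left rfl
  have hg₂ : ContDiff ℝ (↑(⊤ : ℕ∞)) (Complex.ofRealCLM ∘ g) := by fun_prop
  set G : SchwartzMap (Space d) ℂ := hg₁.toSchwartzMap hg₂ with hG
  have h1 := congrArg (fun D : TemperedDistribution (Space d) ℂ => D G)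
    (Lp.fourierInv_toTemperedDistribution_eq f)
  simp only [TemperedDistribution.fourierInv_apply, Lp.toTemperedDistribution_apply] at h1
  have h2 : ∀ x, G x = (g x : ℂ) := fun x => rfl
  have h3 := integral_fourierInv_smul_eq (d := d) G.integrable hf
  rw [← SchwartzMap.fourierInv_coe, h1] at h3
  simpa [h2] using h3

/-- Bessel's inequality for the functions `𝓕⁻ (k Fᵢ)`, with `k ∈ L²` and `Fᵢ` orthonormal. -/
theorem sum_enorm_fourierInv_sq_le {ι : Type*} [Fintype ι] {F : ι → HSpace d}
    (hF : Orthonormal ℂ F) {k : Space d → ℝ} (hk : MemLp (fun ξ => (k ξ : ℂ)) 2 volume)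
    {h : ι → HSpace d} (hh : ∀ i, h i =ᵐ[volume] fun ξ => (k ξ : ℂ) * F i ξ) :
    ∀ᵐ x, ∑ i, ‖(𝓕⁻ (h i) : HSpace d) x‖ₑ ^ 2 ≤ ∫⁻ ξ, ‖k ξ‖ₑ ^ 2 := by
  have hint : ∀ i, Integrable (h i) := fun i =>
    (hk.integrable_mul (Lp.memLp (F i))).congr (hh i).symm
  have hae : ∀ᵐ x, ∀ i, (𝓕⁻ (h i) : HSpace d) x = 𝓕⁻ (h i : Space d → ℂ) x :=
    ae_all_iff.mpr fun i => fourierInv_coeFn_ae (h i) (hint i)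
  filter_upwards [hae] with x hx
  -- For fixed `x` the value of the transform is the inner product of `F i` with the single vector
  -- `K`, a unimodular character times `k`. The sign in the character is undone by the conjugation
  -- in the inner product.
  have hK : MemLp (fun ξ => (Real.fourierChar (-inner ℝ ξ x) : ℂ) * (k ξ : ℂ)) 2 volume := by
    refine hk.of_le ?_ ?_
    · refine AEStronglyMeasurable.mul ?_ hk.1
      exact (Continuous.comp continuous_subtype_val
        (Real.continuous_fourierChar.comp (by fun_prop))).aestronglyMeasurable
    · filter_upwards with ξ
      rw [norm_mul, Circle.norm_coe, one_mul]
  set K : HSpace d := hK.toLp _ with hKdef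
  have hinner : ∀ i, inner ℂ K (F i) = (𝓕⁻ (h i) : HSpace d) x := by
    intro i
    rw [hx i, Real.fourierInv_eq, L2.inner_def]
    apply integral_congr_ae
    filter_upwards [hK.coeFn_toLp, hh i] with ξ h1 h2
    rw [← hKdef] at h1
    rw [h1, h2, RCLike.inner_apply, map_mul, Complex.conj_ofReal, Circle.smul_def, smul_eq_mul,
      AddChar.map_neg_eq_inv, Circle.coe_inv_eq_conj, Complex.conj_conj]
    ring
  have hbes := hF.sum_inner_products_le K (s := Finset.univ)
  have hnorm : ENNReal.ofReal (‖K‖ ^ 2) = ∫⁻ ξ, ‖k ξ‖ₑ ^ 2 := by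
    rw [ENNReal.ofReal_pow (norm_nonneg _), ofReal_norm, hKdef, Lp.enorm_toLp]
    have := eLpNorm_nnreal_pow_eq_lintegral (μ := volume) (p := 2)
      (f := fun ξ => (Real.fourierChar (-inner ℝ ξ x) : ℂ) * (k ξ : ℂ)) (by norm_num)
    simp only [NNReal.coe_ofNat, ENNReal.rpow_ofNat, ENNReal.coe_ofNat] at this
    rw [this]
    congr 1 with ξ
    congr 1
    rw [← ofReal_norm, ← ofReal_norm, norm_mul, Circle.norm_coe, one_mul, Complex.norm_real]
  rw [← hnorm]
  refine le_trans (le_of_eq ?_) (ENNReal.ofReal_le_ofReal hbes)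
  rw [ENNReal.ofReal_sum_of_nonneg (fun i _ => by positivity)]
  refine Finset.sum_congr rfl fun i _ => ?_
  rw [ENNReal.ofReal_pow (norm_nonneg _), norm_inner_symm, hinner, ofReal_norm]

/-- Plancherel's theorem for the inverse Fourier transform. -/
theorem lintegral_enorm_fourierInv_sq (f : HSpace d) :
    ∫⁻ x, ‖(𝓕⁻ f : HSpace d) x‖ₑ ^ 2 = ∫⁻ ξ, ‖f ξ‖ₑ ^ 2 := by
  have key : ∀ g : HSpace d, ∫⁻ x, ‖g x‖ₑ ^ 2 = ‖g‖ₑ ^ 2 := by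
    intro g
    have := eLpNorm_nnreal_pow_eq_lintegral (μ := volume) (p := 2) (f := g) (by norm_num)
    simp only [NNReal.coe_ofNat, ENNReal.rpow_ofNat, ENNReal.coe_ofNat] at this
    rw [← this, Lp.enorm_def]
  rw [key, key, ← ofReal_norm, ← ofReal_norm, ← Lp.norm_fourier_eq (𝓕⁻ f),
    FourierTransform.fourier_fourierInv_eq]

/-! ## Cwikel's estimate -/

/-- Geometric series below the largest power of `4` not exceeding `t`. It gives the factor `4/3`;
the cruder `4` is what produces the constant `4α` in the end. -/
theorem tsum_zpow_indicator_le {t : ℝ} (ht : 0 < t) :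
    ∑' n : ℤ, (if (4 : ℝ) ^ n ≤ t then ENNReal.ofReal (4 ^ n) else 0) ≤ 4 * ENNReal.ofReal t := by
  obtain ⟨N, hN1, hN2⟩ := exists_mem_Ico_zpow ht (by norm_num : (1 : ℝ) < 4)
  have hinj : Function.Injective fun k : ℕ => N - (k : ℤ) := by
    intro a b h
    simpa using h
  have hsupp : Function.support
      (fun n : ℤ => if (4 : ℝ) ^ n ≤ t then ENNReal.ofReal (4 ^ n) else 0)
      ⊆ Set.range fun k : ℕ => N - (k : ℤ) := by
    intro n hn
    have h4 : (4 : ℝ) ^ n ≤ t := by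
      by_contra h
      simp [h] at hn
    have hlt : n < N + 1 := (zpow_lt_zpow_iff_right₀ (by norm_num : (1 : ℝ) < 4)).mp
      (h4.trans_lt hN2)
    exact ⟨(N - n).toNat, by simp only []; omega⟩
  rw [← hinj.tsum_eq hsupp]
  calc ∑' k : ℕ, (if (4 : ℝ) ^ (N - (k : ℤ)) ≤ t then ENNReal.ofReal (4 ^ (N - (k : ℤ))) else 0)
      ≤ ∑' k : ℕ, ENNReal.ofReal t * (4⁻¹ : ℝ≥0∞) ^ k := by
        refine ENNReal.tsum_le_tsum fun k => ?_
        split_ifs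
        · rw [zpow_sub₀ (by norm_num), zpow_natCast, div_eq_mul_inv,
            ENNReal.ofReal_mul (by positivity), ← inv_pow, ENNReal.ofReal_pow (by positivity),
            ENNReal.ofReal_inv_of_pos (by norm_num), ENNReal.ofReal_ofNat]
          gcongr
        · exact zero_le
    _ = ENNReal.ofReal t * (1 - 4⁻¹)⁻¹ := by rw [ENNReal.tsum_mul_left, ENNReal.tsum_geometric]
    _ ≤ 4 * ENNReal.ofReal t := by
        rw [mul_comm]
        gcongr
        rw [ENNReal.inv_le_iff_inv_le]
        refine ENNReal.le_sub_of_add_le_left (by simp) ?_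
        calc (4⁻¹ : ℝ≥0∞) + 4⁻¹ ≤ 2⁻¹ + 2⁻¹ := by
              gcongr <;> norm_num
          _ = 1 := ENNReal.inv_two_add_inv_two

/-- Weighted Cauchy–Schwarz: the difference of the two sides is a square over `β (1 - β)`. It is
used with `β = 4α`. -/
theorem enorm_add_sq_le {β : ℝ} (h0 : 0 < β) (h1 : β < 1) (a b : ℂ) :
    ‖a + b‖ₑ ^ 2 ≤ ENNReal.ofReal (1 / β) * ‖a‖ₑ ^ 2
      + ENNReal.ofReal (1 / (1 - β)) * ‖b‖ₑ ^ 2 := by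
  have h2 : 0 < 1 - β := by linarith
  simp only [← ofReal_norm]
  rw [← ENNReal.ofReal_pow (norm_nonneg _), ← ENNReal.ofReal_pow (norm_nonneg _),
    ← ENNReal.ofReal_pow (norm_nonneg _), ← ENNReal.ofReal_mul (by positivity),
    ← ENNReal.ofReal_mul (by positivity), ← ENNReal.ofReal_add (by positivity) (by positivity)]
  apply ENNReal.ofReal_le_ofReal
  have hab : ‖a + b‖ ^ 2 ≤ (‖a‖ + ‖b‖) ^ 2 := by
    gcongr
    exact norm_add_le a b
  refine hab.trans ?_
  have : 1 / β * ‖a‖ ^ 2 + 1 / (1 - β) * ‖b‖ ^ 2 - (‖a‖ + ‖b‖) ^ 2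
      = ((1 - β) * ‖a‖ - β * ‖b‖) ^ 2 / (β * (1 - β)) := by
    field_simp
    ring
  have h3 : 0 ≤ ((1 - β) * ‖a‖ - β * ‖b‖) ^ 2 / (β * (1 - β)) := by positivity
  linarith

theorem lintegral_enorm_sq_eq_one {F : HSpace d} (hF : ‖F‖ = 1) : ∫⁻ ξ, ‖F ξ‖ₑ ^ 2 = 1 := by
  have := eLpNorm_nnreal_pow_eq_lintegral (μ := volume) (p := 2) (f := F) (by norm_num)
  simp only [NNReal.coe_ofNat, ENNReal.rpow_ofNat, ENNReal.coe_ofNat] at this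
  rw [← this, ← Lp.enorm_def, ← ofReal_norm, hF]
  simp

/-- The part of `φ` living on the momenta in `R`. -/
def restrictLp (φ : HSpace d) {R : Set (Space d)} (hR : MeasurableSet R) : HSpace d :=
  ((Lp.memLp φ).indicator hR).toLp _

theorem restrictLp_ae (φ : HSpace d) {R : Set (Space d)} (hR : MeasurableSet R) :
    restrictLp φ hR =ᵐ[volume] R.indicator φ :=
  ((Lp.memLp φ).indicator hR).coeFn_toLp

theorem restrictLp_add_compl (φ : HSpace d) {R : Set (Space d)} (hR : MeasurableSet R) :
    restrictLp φ hR + restrictLp φ hR.compl = φ := by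
  apply Lp.ext
  filter_upwards [Lp.coeFn_add (restrictLp φ hR) (restrictLp φ hR.compl), restrictLp_ae φ hR,
    restrictLp_ae φ hR.compl] with ξ h1 h2 h3
  rw [h1, Pi.add_apply, h2, h3, Set.indicator_self_add_compl_apply]

/-- The momenta above an energy threshold contribute a bounded operator. -/
theorem tsum_highEnergy_le {τ : Space d → ℝ} (hτm : Measurable τ) (hτ0 : ∀ᵐ ξ, 0 < τ ξ)
    {F φ : HSpace d} (hF : ‖F‖ = 1) (hφ : F =ᵐ[volume] fun ξ => ((√(τ ξ) : ℝ) : ℂ) * φ ξ)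
    {w : Space d → ℝ} (hw : Measurable w) {α : ℝ} (hα : 0 < α) :
    ∑' n : ℤ, ∫⁻ x in (fun x => w x / α ^ 2) ⁻¹' Set.Ioc (4 ^ n) (4 ^ (n + 1)),
      ENNReal.ofReal (w x) *
        ‖(𝓕⁻ (restrictLp φ (measurableSet_lt hτm (measurable_const (a := (4 : ℝ) ^ n))).compl) :
          HSpace d) x‖ₑ ^ 2
      ≤ ENNReal.ofReal (16 * α ^ 2) := by
  have hR : ∀ n : ℤ, MeasurableSet {ξ | τ ξ < (4 : ℝ) ^ n} := fun n =>
    measurableSet_lt hτm (measurable_const (a := (4 : ℝ) ^ n))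
  have hS : ∀ n : ℤ, MeasurableSet
      ((fun x => w x / α ^ 2) ⁻¹' Set.Ioc ((4 : ℝ) ^ n) (4 ^ (n + 1))) := fun n =>
    (hw.div_const _) measurableSet_Ioc
  have hstep : ∀ n : ℤ, ∫⁻ x in (fun x => w x / α ^ 2) ⁻¹' Set.Ioc (4 ^ n) (4 ^ (n + 1)),
      ENNReal.ofReal (w x) * ‖(𝓕⁻ (restrictLp φ (hR n).compl) : HSpace d) x‖ₑ ^ 2
      ≤ ∫⁻ ξ, ENNReal.ofReal (4 * α ^ 2) *
        (if (4 : ℝ) ^ n ≤ τ ξ then ENNReal.ofReal (4 ^ n) else 0) * ‖φ ξ‖ₑ ^ 2 := by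
    intro n
    calc _ ≤ ∫⁻ x in (fun x => w x / α ^ 2) ⁻¹' Set.Ioc (4 ^ n) (4 ^ (n + 1)),
          ENNReal.ofReal (4 * α ^ 2 * 4 ^ n) *
            ‖(𝓕⁻ (restrictLp φ (hR n).compl) : HSpace d) x‖ₑ ^ 2 := by
          refine setLIntegral_mono' (hS n) fun x hx => ?_
          gcongr
          have h1 : w x / α ^ 2 ≤ 4 ^ n * 4 := by
            rw [← zpow_add_one₀ (by norm_num)]
            exact hx.2
          rw [div_le_iff₀ (by positivity)] at h1
          linarith
      _ ≤ ∫⁻ x, ENNReal.ofReal (4 * α ^ 2 * 4 ^ n) *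
            ‖(𝓕⁻ (restrictLp φ (hR n).compl) : HSpace d) x‖ₑ ^ 2 := setLIntegral_le_lintegral _ _
      _ = ENNReal.ofReal (4 * α ^ 2 * 4 ^ n) * ∫⁻ ξ, ‖restrictLp φ (hR n).compl ξ‖ₑ ^ 2 := by
          rw [lintegral_const_mul' _ _ ENNReal.ofReal_ne_top, lintegral_enorm_fourierInv_sq]
      _ = _ := by
          rw [← lintegral_const_mul' _ _ ENNReal.ofReal_ne_top]
          apply lintegral_congr_ae
          filter_upwards [restrictLp_ae φ (hR n).compl] with ξ hξ
          rw [hξ]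
          by_cases h : (4 : ℝ) ^ n ≤ τ ξ
          · rw [Set.indicator_of_mem (by simpa using h), if_pos h,
              ENNReal.ofReal_mul (by positivity)]
          · rw [Set.indicator_of_notMem (by simpa using h), if_neg h]
            simp
  refine (ENNReal.tsum_le_tsum hstep).trans ?_
  -- With the sum inside the integral, at each `ξ` the powers `4^n ≤ τ` add up to at most `4τ`, and
  -- `τ |φ|² = |F|²`.
  rw [← lintegral_tsum]
  · calc _ ≤ ∫⁻ ξ, ENNReal.ofReal (16 * α ^ 2) * ‖F ξ‖ₑ ^ 2 := by
          apply lintegral_mono_ae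
          filter_upwards [hτ0, hφ] with ξ hξ h2
          rw [ENNReal.tsum_mul_right, ENNReal.tsum_mul_left, h2, enorm_mul, mul_pow, ← mul_assoc]
          refine mul_le_mul_left ?_ _
          refine (mul_le_mul_right (tsum_zpow_indicator_le hξ) _).trans (le_of_eq ?_)
          rw [← ofReal_norm, Complex.norm_real, Real.norm_eq_abs, abs_of_nonneg (Real.sqrt_nonneg _),
            ← ENNReal.ofReal_pow (Real.sqrt_nonneg _), Real.sq_sqrt hξ.le, ← mul_assoc]
          congr 1
          rw [← ENNReal.ofReal_ofNat, ← ENNReal.ofReal_mul (by positivity)]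
          congr 1
          ring
      _ = ENNReal.ofReal (16 * α ^ 2) := by
          rw [lintegral_const_mul' _ _ ENNReal.ofReal_ne_top, lintegral_enorm_sq_eq_one hF, mul_one]
  · intro n
    refine AEMeasurable.mul (AEMeasurable.mul aemeasurable_const ?_) ?_
    · exact (Measurable.ite (measurableSet_le measurable_const hτm) measurable_const
        measurable_const).aemeasurable
    · exact (Lp.aestronglyMeasurable φ).enorm.pow_const _

/-- The momenta below an energy threshold contribute a Hilbert–Schmidt operator. -/
theorem sum_tsum_lowEnergy_le {ι : Type*} [Fintype ι] {τ : Space d → ℝ} (hτm : Measurable τ)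
    (hτ0 : ∀ᵐ ξ, 0 < τ ξ)
    (hfin : ∀ u : ℝ, ∫⁻ ξ in {ξ | τ ξ < u}, (ENNReal.ofReal (τ ξ))⁻¹ < ∞)
    {F φ : ι → HSpace d} (hF : Orthonormal ℂ F)
    (hφ : ∀ i, F i =ᵐ[volume] fun ξ => ((√(τ ξ) : ℝ) : ℂ) * φ i ξ)
    {w : Space d → ℝ} (hw : Measurable w) {α : ℝ} :
    ∑ i, ∑' n : ℤ, ∫⁻ x in (fun x => w x / α ^ 2) ⁻¹' Set.Ioc (4 ^ n) (4 ^ (n + 1)),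
      ENNReal.ofReal (w x) *
        ‖(𝓕⁻ (restrictLp (φ i) (measurableSet_lt hτm (measurable_const (a := (4 : ℝ) ^ n)))) :
          HSpace d) x‖ₑ ^ 2
      ≤ ∫⁻ x, ENNReal.ofReal (w x) *
          ∫⁻ ξ in {ξ | τ ξ < w x / α ^ 2}, (ENNReal.ofReal (τ ξ))⁻¹ := by
  have hR : ∀ n : ℤ, MeasurableSet {ξ | τ ξ < (4 : ℝ) ^ n} := fun n =>
    measurableSet_lt hτm (measurable_const (a := (4 : ℝ) ^ n))
  have hS : ∀ n : ℤ, MeasurableSet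
      ((fun x => w x / α ^ 2) ⁻¹' Set.Ioc ((4 : ℝ) ^ n) (4 ^ (n + 1))) := fun n =>
    (hw.div_const _) measurableSet_Ioc
  have hbessel : ∀ n : ℤ, ∀ᵐ x, ∑ i, ‖(𝓕⁻ (restrictLp (φ i) (hR n)) : HSpace d) x‖ₑ ^ 2
      ≤ ∫⁻ ξ in {ξ | τ ξ < (4 : ℝ) ^ n}, (ENNReal.ofReal (τ ξ))⁻¹ := by
    intro n
    -- On low momenta `φ i = τ^(-1/2) F i`, so Bessel's inequality applies with this
    -- square-integrable `k`.
    set k : Space d → ℝ := {ξ | τ ξ < (4 : ℝ) ^ n}.indicator fun ξ => (√(τ ξ))⁻¹ with hk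
    have hkm : Measurable k := (hτm.sqrt.inv).indicator (hR n)
    have hkint : ∫⁻ ξ, ‖k ξ‖ₑ ^ 2
        = ∫⁻ ξ in {ξ | τ ξ < (4 : ℝ) ^ n}, (ENNReal.ofReal (τ ξ))⁻¹ := by
      rw [← lintegral_indicator (hR n)]
      apply lintegral_congr_ae
      filter_upwards [hτ0] with ξ hξ
      by_cases h : ξ ∈ {ξ | τ ξ < (4 : ℝ) ^ n}
      · rw [hk, Set.indicator_of_mem h, Set.indicator_of_mem h, ← ofReal_norm, Real.norm_eq_abs,
          abs_of_nonneg (by positivity), ← ENNReal.ofReal_pow (by positivity), inv_pow,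
          Real.sq_sqrt hξ.le, ENNReal.ofReal_inv_of_pos hξ]
      · rw [hk, Set.indicator_of_notMem h, Set.indicator_of_notMem h]
        simp
    have hkL : MemLp (fun ξ => (k ξ : ℂ)) 2 volume := by
      refine ⟨(Complex.measurable_ofReal.comp hkm).aestronglyMeasurable, ?_⟩
      have := eLpNorm_nnreal_pow_eq_lintegral (μ := volume) (p := 2)
        (f := fun ξ => (k ξ : ℂ)) (by norm_num)
      simp only [NNReal.coe_ofNat, ENNReal.rpow_ofNat, ENNReal.coe_ofNat] at this
      have h2 : ∀ ξ, ‖(k ξ : ℂ)‖ₑ = ‖k ξ‖ₑ := fun ξ => by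
        rw [← ofReal_norm, ← ofReal_norm, Complex.norm_real]
      simp only [h2, hkint] at this
      have h3 := hfin ((4 : ℝ) ^ n)
      rw [← this] at h3
      exact (ENNReal.pow_lt_top_iff.mp h3).resolve_right (by norm_num)
    rw [← hkint]
    refine sum_enorm_fourierInv_sq_le hF hkL fun i => ?_
    filter_upwards [restrictLp_ae (φ i) (hR n), hφ i, hτ0] with ξ h1 h2 h3
    rw [h1, h2, hk]
    by_cases h : ξ ∈ {ξ | τ ξ < (4 : ℝ) ^ n}
    · rw [Set.indicator_of_mem h, Set.indicator_of_mem h]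
      have : ((√(τ ξ) : ℝ) : ℂ) ≠ 0 := by
        exact_mod_cast (Real.sqrt_pos.mpr h3).ne'
      push_cast
      field_simp
    · rw [Set.indicator_of_notMem h, Set.indicator_of_notMem h]
      simp
  have hmeas : ∀ n : ℤ, ∀ i, AEMeasurable (fun x => ENNReal.ofReal (w x) *
      ‖(𝓕⁻ (restrictLp (φ i) (hR n)) : HSpace d) x‖ₑ ^ 2) volume := fun n i =>
    (hw.ennreal_ofReal.aemeasurable).mul
      ((Lp.aestronglyMeasurable (𝓕⁻ (restrictLp (φ i) (hR n)) : HSpace d)).enorm.pow_const _)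
  rw [← Summable.tsum_finsetSum fun i _ => ENNReal.summable]
  calc _ ≤ ∑' n : ℤ, ∫⁻ x in (fun x => w x / α ^ 2) ⁻¹' Set.Ioc (4 ^ n) (4 ^ (n + 1)),
        ENNReal.ofReal (w x) *
          ∫⁻ ξ in {ξ | τ ξ < w x / α ^ 2}, (ENNReal.ofReal (τ ξ))⁻¹ := by
        refine ENNReal.tsum_le_tsum fun n => ?_
        rw [← lintegral_finsetSum' _ fun i _ => (hmeas n i).restrict]
        apply lintegral_mono_ae
        filter_upwards [ae_restrict_of_ae (hbessel n), ae_restrict_mem (hS n)] with x hx hxS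
        rw [← Finset.mul_sum]
        gcongr
        -- On shell `n` the cut-off `4^n` lies below `w/α²`, so the low momenta belong to the larger
        -- sublevel set, which no longer depends on `n`.
        refine hx.trans (lintegral_mono_set fun ξ hξ => ?_)
        exact lt_trans hξ hxS.1
    _ = ∫⁻ x in ⋃ n : ℤ, (fun x => w x / α ^ 2) ⁻¹' Set.Ioc (4 ^ n) (4 ^ (n + 1)),
        ENNReal.ofReal (w x) *
          ∫⁻ ξ in {ξ | τ ξ < w x / α ^ 2}, (ENNReal.ofReal (τ ξ))⁻¹ := by
        rw [lintegral_iUnion hS]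
        intro m n hmn
        exact ((zpow_right_mono₀ (by norm_num : (1 : ℝ) ≤ 4)).pairwise_disjoint_on_Ioc_succ
          hmn).preimage _
    _ ≤ _ := setLIntegral_le_lintegral _ _

/-- Cwikel's bound: if `√τ φᵢ` are orthonormal and `⟨𝓕⁻ φᵢ, w 𝓕⁻ φᵢ⟩ ≥ 1`, then the number of the
`φᵢ` is bounded by the phase space integral of `w / τ` over `τ < w / α²`. -/
theorem card_le_phaseSpace {ι : Type*} [Fintype ι] {τ : Space d → ℝ} (hτm : Measurable τ)
    (hτ0 : ∀ᵐ ξ, 0 < τ ξ)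
    (hfin : ∀ u : ℝ, ∫⁻ ξ in {ξ | τ ξ < u}, (ENNReal.ofReal (τ ξ))⁻¹ < ∞)
    {F φ : ι → HSpace d} (hF : Orthonormal ℂ F)
    (hφ : ∀ i, F i =ᵐ[volume] fun ξ => ((√(τ ξ) : ℝ) : ℂ) * φ i ξ)
    {w : Space d → ℝ} (hw : Measurable w) {α : ℝ} (hα : 0 < α) (hα' : α < 1 / 4)
    (h1 : ∀ i, 1 ≤ ∫⁻ x, ENNReal.ofReal (w x) * ‖(𝓕⁻ (φ i) : HSpace d) x‖ₑ ^ 2) :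
    (Fintype.card ι : ℝ≥0∞) ≤ ENNReal.ofReal (1 / (1 - 4 * α) ^ 2) *
      ∫⁻ x, ENNReal.ofReal (w x) *
          ∫⁻ ξ in {ξ | τ ξ < w x / α ^ 2}, (ENNReal.ofReal (τ ξ))⁻¹ := by
  have hR : ∀ n : ℤ, MeasurableSet {ξ | τ ξ < (4 : ℝ) ^ n} := fun n =>
    measurableSet_lt hτm (measurable_const (a := (4 : ℝ) ^ n))
  set S : ℤ → Set (Space d) := fun n =>
    (fun x => w x / α ^ 2) ⁻¹' Set.Ioc ((4 : ℝ) ^ n) (4 ^ (n + 1)) with hSdef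
  have hS : ∀ n : ℤ, MeasurableSet (S n) := fun n => (hw.div_const _) measurableSet_Ioc
  have hβ0 : 0 < 4 * α := by linarith
  have hβ1 : 0 < 1 - 4 * α := by linarith
  set X := ∫⁻ x, ENNReal.ofReal (w x) *
          ∫⁻ ξ in {ξ | τ ξ < w x / α ^ 2}, (ENNReal.ofReal (τ ξ))⁻¹ with hX
  set lo : ι → ℤ → Space d → ℝ≥0∞ := fun i n x => ENNReal.ofReal (w x) *
    ‖(𝓕⁻ (restrictLp (φ i) (hR n)) : HSpace d) x‖ₑ ^ 2 with hlo
  set hi : ι → ℤ → Space d → ℝ≥0∞ := fun i n x => ENNReal.ofReal (w x) *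
    ‖(𝓕⁻ (restrictLp (φ i) (hR n).compl) : HSpace d) x‖ₑ ^ 2 with hhi
  have hhim : ∀ i n, AEMeasurable (hi i n) volume := fun i n =>
    (hw.ennreal_ofReal.aemeasurable).mul
      ((Lp.aestronglyMeasurable
        (𝓕⁻ (restrictLp (φ i) (hR n).compl) : HSpace d)).enorm.pow_const _)
  have hsplit : ∀ i, ∫⁻ x, ENNReal.ofReal (w x) * ‖(𝓕⁻ (φ i) : HSpace d) x‖ₑ ^ 2
      ≤ ENNReal.ofReal (1 / (4 * α)) * (∑' n, ∫⁻ x in S n, hi i n x)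
        + ENNReal.ofReal (1 / (1 - 4 * α)) * (∑' n, ∫⁻ x in S n, lo i n x) := by
    intro i
    calc _ ≤ ∫⁻ x in ⋃ n, S n, ENNReal.ofReal (w x) * ‖(𝓕⁻ (φ i) : HSpace d) x‖ₑ ^ 2 := by
          rw [← lintegral_indicator (MeasurableSet.iUnion hS)]
          refine lintegral_mono fun x => ?_
          by_cases hx : 0 < w x
          · obtain ⟨n, hn⟩ := exists_mem_Ioc_zpow (show 0 < w x / α ^ 2 by positivity)
              (by norm_num : (1 : ℝ) < 4)
            rw [Set.indicator_of_mem (Set.mem_iUnion.mpr ⟨n, hn⟩)]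
          · simp [ENNReal.ofReal_of_nonpos (not_lt.mp hx)]
      _ ≤ ∑' n, ∫⁻ x in S n, ENNReal.ofReal (w x) * ‖(𝓕⁻ (φ i) : HSpace d) x‖ₑ ^ 2 :=
          lintegral_iUnion_le _ _
      _ ≤ ∑' n, (ENNReal.ofReal (1 / (4 * α)) * (∫⁻ x in S n, hi i n x)
          + ENNReal.ofReal (1 / (1 - 4 * α)) * (∫⁻ x in S n, lo i n x)) := by
          refine ENNReal.tsum_le_tsum fun n => ?_
          rw [← lintegral_const_mul' _ _ ENNReal.ofReal_ne_top,
            ← lintegral_const_mul' _ _ ENNReal.ofReal_ne_top,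
            ← lintegral_add_left' ((hhim i n).restrict.const_mul _)]
          apply lintegral_mono_ae
          have hadd : (𝓕⁻ (φ i) : HSpace d) = 𝓕⁻ (restrictLp (φ i) (hR n).compl)
              + 𝓕⁻ (restrictLp (φ i) (hR n)) := by
            rw [← FourierTransform.fourierInv_add, add_comm, restrictLp_add_compl]
          have hae := Lp.coeFn_add (𝓕⁻ (restrictLp (φ i) (hR n).compl) : HSpace d)
              (𝓕⁻ (restrictLp (φ i) (hR n)) : HSpace d)
          rw [← hadd] at hae
          filter_upwards [ae_restrict_of_ae hae] with x hx
          rw [hx, Pi.add_apply]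
          refine (mul_le_mul_right (enorm_add_sq_le hβ0 (by linarith) _ _) _).trans (le_of_eq ?_)
          simp only [hhi, hlo]
          ring
      _ = _ := by rw [ENNReal.tsum_add, ENNReal.tsum_mul_left, ENNReal.tsum_mul_left]
  -- The weight `4α` makes the high-energy share of each index `16α²/(4α) = 4α < 1`, which can be
  -- absorbed on the left.
  have hmain : (Fintype.card ι : ℝ≥0∞) ≤
      ENNReal.ofReal (4 * α) * Fintype.card ι + ENNReal.ofReal (1 / (1 - 4 * α)) * X := by
    calc (Fintype.card ι : ℝ≥0∞) = ∑ i : ι, 1 := by simp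
      _ ≤ ∑ i, (ENNReal.ofReal (1 / (4 * α)) * (∑' n, ∫⁻ x in S n, hi i n x)
        + ENNReal.ofReal (1 / (1 - 4 * α)) * (∑' n, ∫⁻ x in S n, lo i n x)) :=
          Finset.sum_le_sum fun i _ => (h1 i).trans (hsplit i)
      _ = (∑ i, ENNReal.ofReal (1 / (4 * α)) * (∑' n, ∫⁻ x in S n, hi i n x))
        + ENNReal.ofReal (1 / (1 - 4 * α)) * ∑ i, (∑' n, ∫⁻ x in S n, lo i n x) := by
          rw [Finset.sum_add_distrib, Finset.mul_sum Finset.univ _ (ENNReal.ofReal (1 / (1 - _)))]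
      _ ≤ (∑ _i : ι, ENNReal.ofReal (4 * α))
        + ENNReal.ofReal (1 / (1 - 4 * α)) * X := by
          gcongr with i _
          · refine (mul_le_mul_right
              (tsum_highEnergy_le hτm hτ0 (hF.1 i) (hφ i) hw hα) _).trans (le_of_eq ?_)
            rw [← ENNReal.ofReal_mul (by positivity)]
            congr 1
            field_simp
            ring
          · exact sum_tsum_lowEnergy_le hτm hτ0 hfin hF hφ hw
      _ = _ := by
          rw [Finset.sum_const, Finset.card_univ, nsmul_eq_mul, mul_comm]
  by_cases hXtop : X = ∞
  · rw [hXtop, ENNReal.mul_top (by simpa using by positivity)]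
    exact le_top
  · rw [← ENNReal.ofReal_toReal hXtop, ← ENNReal.ofReal_natCast,
      ← ENNReal.ofReal_mul (by positivity), ← ENNReal.ofReal_mul (by positivity),
      ← ENNReal.ofReal_add (by positivity) (by positivity),
      ENNReal.ofReal_le_ofReal_iff (by positivity)] at hmain
    rw [← ENNReal.ofReal_toReal hXtop, ← ENNReal.ofReal_natCast,
      ← ENNReal.ofReal_mul (by positivity)]
    apply ENNReal.ofReal_le_ofReal
    have h2 : (1 - 4 * α) * (Fintype.card ι : ℝ) ≤ X.toReal / (1 - 4 * α) := by
      rw [one_div_mul_eq_div] at hmain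
      linarith
    rw [one_div_mul_eq_div, sq, ← div_div]
    rw [le_div_iff₀ hβ1]
    linarith

/-! ## The one-dimensional inequality for the sublevel volumes -/

/-- The squared invariant mass of a pair of energy `E + g`, where `g² = |P|² + M²`. -/
def invariantMassSq (g M E : ℝ) : ℝ := E ^ 2 + 2 * E * g + M ^ 2

/-- Up to a constant, the volume of `{T < E}` divided by `E^{3/2}`. -/
def volumeFactor (g M q E : ℝ) : ℝ :=
  √(E + 2 * g) ^ 3 * (E + g) / √(invariantMassSq g M E) *
    √((invariantMassSq g M E - q) / invariantMassSq g M E) ^ 3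

theorem le_invariantMassSq {g M E : ℝ} (hg : 0 < g) (hE : 0 ≤ E) :
    M ^ 2 ≤ invariantMassSq g M E := by
  unfold invariantMassSq
  have : 0 ≤ E * g := by positivity
  nlinarith [sq_nonneg E]

theorem invariantMassSq_pos {g M E : ℝ} (hg : 0 < g) (hM : 0 < M) (hE : 0 ≤ E) :
    0 < invariantMassSq g M E := lt_of_lt_of_le (by positivity) (le_invariantMassSq hg hE)

theorem hasDerivAt_invariantMassSq (g M E : ℝ) :
    HasDerivAt (invariantMassSq g M) (2 * (E + g)) E := by
  unfold invariantMassSq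
  have h := (((hasDerivAt_id E).pow 2).add (((hasDerivAt_id E).const_mul 2).mul_const g)).add_const
    (M ^ 2)
  refine h.congr_deriv ?_
  simp
  ring

theorem continuous_invariantMassSq (g M : ℝ) : Continuous (invariantMassSq g M) := by
  unfold invariantMassSq
  fun_prop

/-- The logarithmic derivative of `volumeFactor` for `q = 0` bounds it from below in general. -/
theorem exists_hasDerivAt_volumeFactor {g M p q E : ℝ} (hg : 0 < g) (hM : 0 < M)
    (hgp : g ^ 2 = p ^ 2 + M ^ 2) (hq0 : 0 ≤ q) (hq : q < M ^ 2) (hE : 0 < E) :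
    ∃ k', HasDerivAt (volumeFactor g M q) k' E ∧
      volumeFactor g M q E *
        (3 / (2 * (E + 2 * g)) - p ^ 2 / (invariantMassSq g M E * (E + g))) ≤ k' := by
  have hs := invariantMassSq_pos (M := M) hg hM hE.le
  have hsM := le_invariantMassSq (M := M) hg hE.le
  have hds := hasDerivAt_invariantMassSq g M E
  set s := invariantMassSq g M E with hsdef
  have hsp : s = (E + g) ^ 2 - p ^ 2 := by
    rw [hsdef, invariantMassSq]
    linear_combination -hgp
  have hE2 : 0 < E + 2 * g := by linarith
  have hE1 : 0 < E + g := by linarith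
  have hr : 0 < (s - q) / s := div_pos (by linarith) hs
  have hA : HasDerivAt (fun E => √(E + 2 * g) ^ 3 * (E + g) / √(invariantMassSq g M E))
      (√(E + 2 * g) ^ 3 * (E + g) / √s * (3 / (2 * (E + 2 * g)) - p ^ 2 / (s * (E + g)))) E := by
    have h1 : HasDerivAt (fun E => √(E + 2 * g)) (1 / (2 * √(E + 2 * g))) E :=
      ((hasDerivAt_id E).add_const (2 * g)).sqrt hE2.ne'
    have h2 := ((h1.fun_pow 3).mul ((hasDerivAt_id E).add_const g)).div
      (hds.sqrt hs.ne') (Real.sqrt_pos.mpr hs).ne'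
    refine h2.congr_deriv ?_
    have hx := Real.sqrt_pos.mpr hE2
    have hy := Real.sqrt_pos.mpr hs
    have hx2 := Real.sq_sqrt hE2.le
    have hy2 := Real.sq_sqrt hs.le
    rw [← hsdef]
    simp only [id, Pi.mul_apply]
    set x := √(E + 2 * g)
    set y := √s
    -- In terms of the two square roots the derivative formula becomes an identity of rational
    -- functions.
    have e1 : E + 2 * g = x ^ 2 := hx2.symm
    have e2 : s = y ^ 2 := hy2.symm
    have e3 : p ^ 2 = (E + g) ^ 2 - y ^ 2 := by rw [← e2, hsp]; ring
    rw [e1, e3, e2]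
    field_simp
    ring
  have hB : HasDerivAt (fun E => √((invariantMassSq g M E - q) / invariantMassSq g M E) ^ 3)
      (3 * √((s - q) / s) ^ 2 * ((2 * (E + g) * q / s ^ 2) / (2 * √((s - q) / s)))) E := by
    have h1 := ((((hds.sub_const q).div hds hs.ne').sqrt hr.ne').fun_pow 3)
    refine h1.congr_deriv ?_
    simp only [Pi.div_apply, ← hsdef]
    congr 1
    congr 1
    field_simp
    ring
  refine ⟨_, hA.mul hB, ?_⟩
  -- The factor containing `q` is nondecreasing in `E`, so its part of the derivative can be dropped
  -- from a lower bound.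
  have hnn : 0 ≤ √(E + 2 * g) ^ 3 * (E + g) / √s *
      (3 * √((s - q) / s) ^ 2 * ((2 * (E + g) * q / s ^ 2) / (2 * √((s - q) / s)))) := by
    positivity
  rw [volumeFactor, ← hsdef]
  linarith

/-- Primitive of the correction term. -/
def correction (g M p E : ℝ) : ℝ :=
  p ^ 2 / 4 * (Real.log (invariantMassSq g M E) - Real.log (invariantMassSq g M E + 3 * g ^ 2))

theorem hasDerivAt_correction {g M p E : ℝ} (hg : 0 < g) (hM : 0 < M) (hE : 0 ≤ E) :
    HasDerivAt (correction g M p)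
      (p ^ 2 / 4 * (2 * (E + g) / invariantMassSq g M E
        - 2 * (E + g) / (invariantMassSq g M E + 3 * g ^ 2))) E := by
  have hs := invariantMassSq_pos (M := M) hg hM hE
  have hds := hasDerivAt_invariantMassSq g M E
  exact ((hds.log hs.ne').sub ((hds.add_const _).log (by positivity))).const_mul _

/-- Since `s = E (E + 2g) + M²`, one has `√E √(E + 2g) ≤ √s`, and the factor with `q` is at most
`1`. -/
theorem sqrt_mul_volumeFactor_le {g M q E : ℝ} (hg : 0 < g) (hM : 0 < M)
    (hq0 : 0 ≤ q) (hE : 0 < E) :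
    √E * volumeFactor g M q E ≤ (E + 2 * g) * (E + g) := by
  have hs := invariantMassSq_pos (M := M) hg hM hE.le
  have hE2 : 0 < E + 2 * g := by linarith
  have h1 : √E * √(E + 2 * g) ≤ √(invariantMassSq g M E) := by
    rw [← Real.sqrt_mul hE.le]
    apply Real.sqrt_le_sqrt
    unfold invariantMassSq
    nlinarith [sq_nonneg M]
  unfold volumeFactor
  set s := invariantMassSq g M E
  have h2 : √((s - q) / s) ^ 3 ≤ 1 := by
    refine pow_le_one₀ (Real.sqrt_nonneg _) ?_
    rw [Real.sqrt_le_one]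
    rw [div_le_one hs]
    linarith
  have hx2 := Real.sq_sqrt hE2.le
  have hy := Real.sqrt_pos.mpr hs
  calc √E * (√(E + 2 * g) ^ 3 * (E + g) / √s * √((s - q) / s) ^ 3)
      = (√E * √(E + 2 * g) / √s) * (√(E + 2 * g) ^ 2 * (E + g)) * √((s - q) / s) ^ 3 := by
        field_simp
    _ ≤ 1 * (√(E + 2 * g) ^ 2 * (E + g)) * 1 := by
        gcongr
        exact (div_le_one hy).mpr h1
    _ = _ := by rw [hx2]; ring

theorem volumeFactor_nonneg {g M q E : ℝ} (hg : 0 < g) (hE : 0 ≤ E) :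
    0 ≤ volumeFactor g M q E := by
  unfold volumeFactor
  positivity

/-- With `k` the volume factor, `(√E k / 4)' = k / (8√E) + √E k' / 4`. If `k` were nondecreasing the
first term of the primitive would suffice; the derivative of `correction` compensates for a possibly
negative `k'`. The shift `3g²` in `correction` keeps this compensation integrable at infinity and
still large enough. -/
theorem volumeFactor_div_sqrt_le_deriv {g M p q E : ℝ} (hg : 0 < g) (hM : 0 < M)
    (hgp : g ^ 2 = p ^ 2 + M ^ 2) (hq0 : 0 ≤ q) (hq : q < M ^ 2) (hE : 0 < E) :
    ∃ D, HasDerivAt (fun E => 1 / 4 * (√E * volumeFactor g M q E) + correction g M p E) D E ∧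
      1 / 8 * (volumeFactor g M q E / √E) ≤ D := by
  obtain ⟨k', hk', hk⟩ := exists_hasDerivAt_volumeFactor hg hM hgp hq0 hq hE
  refine ⟨_, ((((hasDerivAt_id E).sqrt hE.ne').mul hk').const_mul (1 / 4)).add
    (hasDerivAt_correction hg hM hE.le), ?_⟩
  have hs := invariantMassSq_pos (M := M) hg hM hE.le
  have hle := sqrt_mul_volumeFactor_le hg hM hq0 hE
  have hnn := volumeFactor_nonneg (M := M) (q := q) hg hE.le
  set s := invariantMassSq g M E
  set k := volumeFactor g M q E
  set L := 3 / (2 * (E + 2 * g)) - p ^ 2 / (s * (E + g)) with hL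
  set C := p ^ 2 * (2 * (E + g) / s - 2 * (E + g) / (s + 3 * g ^ 2)) with hC
  have hE2 : 0 < E + 2 * g := by linarith
  have hE1 : 0 < E + g := by linarith
  have hCeq : C = p ^ 2 * (6 * (E + g) * g ^ 2 / (s * (s + 3 * g ^ 2))) := by
    rw [hC]
    field_simp
    ring
  have hC0 : 0 ≤ C := by
    rw [hCeq]
    positivity
  have hCL : -L * ((E + 2 * g) * (E + g)) ≤ C := by
    have e : C + L * ((E + 2 * g) * (E + g)) =
        (3 / 2 * (E + g) * s * (s + 3 * g ^ 2) + 3 * p ^ 2 * g ^ 2 * E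
          - p ^ 2 * (E + 2 * g) * s) / (s * (s + 3 * g ^ 2)) := by
      rw [hCeq, hL]
      field_simp
      ring
    have : 0 ≤ (3 / 2 * (E + g) * s * (s + 3 * g ^ 2) + 3 * p ^ 2 * g ^ 2 * E
          - p ^ 2 * (E + 2 * g) * s) / (s * (s + 3 * g ^ 2)) := by
      apply div_nonneg _ (by positivity)
      have h1 : p ^ 2 * ((E + 2 * g) * s) ≤ g ^ 2 * ((2 * (E + g)) * s) := by
        refine mul_le_mul ?_ ?_ (by positivity) (by positivity)
        · nlinarith [sq_nonneg M]
        · exact mul_le_mul_of_nonneg_right (by linarith) hs.le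
      have h2 : 0 ≤ (E + g) * s * g ^ 2 := by positivity
      have h3 : 0 ≤ (E + g) * s * s := by positivity
      have h4 : 0 ≤ p ^ 2 * g ^ 2 * E := by positivity
      nlinarith
    linarith
  have hkey : -(√E * k') ≤ C := by
    have h1 : √E * (k * L) ≤ √E * k' := mul_le_mul_of_nonneg_left hk (Real.sqrt_nonneg _)
    have h2 : 0 ≤ √E * k := mul_nonneg (Real.sqrt_nonneg _) hnn
    -- Only a negative logarithmic derivative needs compensation; there `√E k` is replaced by its
    -- bound `(E + 2g)(E + g)`.
    rcases le_total 0 L with h | h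
    · have : 0 ≤ √E * k * L := mul_nonneg h2 h
      nlinarith
    · have : √E * k * -L ≤ (E + 2 * g) * (E + g) * -L :=
        mul_le_mul_of_nonneg_right hle (by linarith)
      nlinarith
  have e : 1 / 4 * (1 / (2 * √E) * k + √E * k') = 1 / 8 * (k / √E) + 1 / 4 * (√E * k') := by
    field_simp
    ring
  simp only [id]
  rw [e]
  have : p ^ 2 / 4 * (2 * (E + g) / s - 2 * (E + g) / (s + 3 * g ^ 2)) = C / 4 := by
    rw [hC]; ring
  rw [this]
  linarith

theorem continuousOn_volumeFactor {g M q : ℝ} (hg : 0 < g) (hM : 0 < M) :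
    ContinuousOn (volumeFactor g M q) (Set.Ici 0) := by
  have hs := fun E (hE : E ∈ Set.Ici (0 : ℝ)) => (invariantMassSq_pos (M := M) hg hM hE).ne'
  have hc := continuous_invariantMassSq g M
  unfold volumeFactor
  refine ContinuousOn.mul (ContinuousOn.div (by fun_prop) (by fun_prop) ?_) ?_
  · intro E hE
    exact (Real.sqrt_pos.mpr (invariantMassSq_pos hg hM hE)).ne'
  · exact (ContinuousOn.sqrt (ContinuousOn.div (by fun_prop) (by fun_prop) hs)).pow 3

/-- Integrate the preceding derivative inequality. The correction is nonpositive at `u`, and its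
value at `0` is minus the logarithmic term. -/
theorem lintegral_volumeFactor_le {g M p q u : ℝ} (hg : 0 < g) (hM : 0 < M)
    (hgp : g ^ 2 = p ^ 2 + M ^ 2) (hq0 : 0 ≤ q) (hq : q < M ^ 2) (hu : 0 < u) :
    ∫⁻ E in Set.Ioo 0 u, ENNReal.ofReal (1 / 8 * (volumeFactor g M q E / √E))
      ≤ ENNReal.ofReal (1 / 4 * (√u * volumeFactor g M q u)
        + p ^ 2 / 4 * Real.log (1 + 3 * g ^ 2 / M ^ 2)) := by
  have hc := continuousOn_volumeFactor (q := q) hg hM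
  have hcI : ContinuousOn (volumeFactor g M q) (Set.Icc 0 u) := hc.mono Set.Icc_subset_Ici_self
  set Ψ : ℝ → ℝ := fun E => 1 / 4 * (√E * volumeFactor g M q E) + correction g M p E with hΨ
  have hΨc : ContinuousOn Ψ (Set.Icc 0 u) := by
    refine ContinuousOn.add (continuousOn_const.mul
      (Real.continuous_sqrt.continuousOn.mul hcI)) fun E hE => ?_
    exact (hasDerivAt_correction hg hM hE.1).continuousAt.continuousWithinAt
  -- The volume factor is continuous up to `0`, so the singularity is only `E^(-1/2)`.
  have hint : IntegrableOn (fun E => 1 / 8 * (volumeFactor g M q E / √E)) (Set.Icc 0 u) := by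
    rw [integrableOn_Icc_iff_integrableOn_Ioc,
      ← intervalIntegrable_iff_integrableOn_Ioc_of_le hu.le]
    have h1 := ((intervalIntegral.intervalIntegrable_rpow' (a := 0) (b := u)
      (show (-1 : ℝ) < -(1 / 2) by norm_num)).continuousOn_mul
      (by rwa [Set.uIcc_of_le hu.le] : ContinuousOn (volumeFactor g M q) (Set.uIcc 0 u))).const_mul
      (1 / 8)
    refine h1.congr fun E hE => ?_
    rw [Set.uIoc_of_le hu.le] at hE
    rw [Real.rpow_neg hE.1.le, ← Real.sqrt_eq_rpow, div_eq_mul_inv (volumeFactor g M q E)]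
  choose! D hD1 hD2 using fun E (hE : E ∈ Set.Ioo 0 u) =>
    volumeFactor_div_sqrt_le_deriv hg hM hgp hq0 hq hE.1
  have hle := intervalIntegral.integral_le_sub_of_hasDeriv_right_of_le hu.le hΨc
    (fun E hE => (hD1 E hE).hasDerivWithinAt) hint hD2
  rw [← ofReal_integral_eq_lintegral_ofReal (hint.mono_set Set.Ioo_subset_Icc_self)]
  · apply ENNReal.ofReal_le_ofReal
    rw [← integral_Ioc_eq_integral_Ioo, ← intervalIntegral.integral_of_le hu.le]
    refine hle.trans ?_
    have hs0 : invariantMassSq g M 0 = M ^ 2 := by simp [invariantMassSq]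
    have hsu := invariantMassSq_pos (M := M) hg hM hu.le
    have hlog : Real.log (invariantMassSq g M u)
        ≤ Real.log (invariantMassSq g M u + 3 * g ^ 2) :=
      Real.log_le_log hsu (by nlinarith [sq_nonneg g])
    have hlog2 : Real.log (1 + 3 * g ^ 2 / M ^ 2)
        = Real.log (M ^ 2 + 3 * g ^ 2) - Real.log (M ^ 2) := by
      rw [← Real.log_div (by positivity) (by positivity)]
      congr 1
      field_simp
    simp only [hΨ, correction, hs0, Real.sqrt_zero, zero_mul, mul_zero, zero_add]
    rw [hlog2]
    have : 0 ≤ p ^ 2 / 4 * (Real.log (invariantMassSq g M u + 3 * g ^ 2)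
      - Real.log (invariantMassSq g M u)) := mul_nonneg (by positivity) (by linarith)
    linarith
  · filter_upwards [ae_restrict_mem measurableSet_Ioo] with E hE
    have := volumeFactor_nonneg (M := M) (q := q) hg hE.1.le
    simp only [Pi.zero_apply]
    positivity

/-- `ln (1 + 3 g² / M²)` is dominated by the logarithm in `modifiedG`. -/
theorem log_le_two_mul_log {t : ℝ} (ht : 0 ≤ t) :
    Real.log (1 + 3 * (t + 1)) ≤ 2 * Real.log (√(1 + t) + √(2 + t)) := by
  have h1 : 0 < √(1 + t) := Real.sqrt_pos.mpr (by linarith)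
  have h2 : √(1 + t) ≤ √(2 + t) := Real.sqrt_le_sqrt (by linarith)
  rw [show (2 : ℝ) * Real.log (√(1 + t) + √(2 + t)) = Real.log ((√(1 + t) + √(2 + t)) ^ 2) by
    rw [Real.log_pow]; norm_num]
  apply Real.log_le_log (by positivity)
  have h3 := Real.sq_sqrt (show 0 ≤ 1 + t by linarith)
  -- Expanding the square gives at least `(1 + t) + (2 + t) + 2(1 + t) = 5 + 4t`, against `4 + 3t`.
  nlinarith

/-! ## Phase space volumes of the pair symbol -/

/-- In centre-of-mass coordinates the sublevel sets of the two-body energy are balls. -/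
theorem boosted_norm_sq_lt {K p P2 m₁ m₂ W s δ τ : ℝ} (hW : 0 < W) (hs : 0 < s)
    (hsW : s = W ^ 2 - P2) (hδ : δ = m₁ ^ 2 - m₂ ^ 2) (hτ : τ = (s + δ) / (2 * s))
    (h : √(K + m₁ ^ 2) + √(P2 - 2 * p + K + m₂ ^ 2) < W) (hK : 0 ≤ K)
    (hK' : 0 ≤ P2 - 2 * p + K) :
    K - 2 * τ * p + τ ^ 2 * P2 - (p - τ * P2) ^ 2 / W ^ 2
      < (s - (m₁ + m₂) ^ 2) * (s - (m₁ - m₂) ^ 2) / (4 * s) := by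
  have hx0 := Real.sqrt_nonneg (K + m₁ ^ 2)
  have hy0 := Real.sqrt_nonneg (P2 - 2 * p + K + m₂ ^ 2)
  have hx2 := Real.sq_sqrt (show 0 ≤ K + m₁ ^ 2 by positivity)
  have hy2 := Real.sq_sqrt (show 0 ≤ P2 - 2 * p + K + m₂ ^ 2 by positivity)
  set x := √(K + m₁ ^ 2)
  set y := √(P2 - 2 * p + K + m₂ ^ 2)
  -- This is `y² < (W - x)²` with the quadratic terms in the momentum cancelled; squaring once more
  -- removes the last root.
  have h1 : 2 * W * x < s + δ + 2 * p := by nlinarith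
  have h2 : (2 * W * x) ^ 2 < (s + δ + 2 * p) ^ 2 := by
    have : 0 ≤ 2 * W * x := by positivity
    nlinarith
  have h3 : 0 < (s + δ + 2 * p) ^ 2 - 4 * W ^ 2 * (K + m₁ ^ 2) := by
    rw [← hx2]
    linarith
  have hP2 : P2 = W ^ 2 - s := by linarith
  have e : (s - (m₁ + m₂) ^ 2) * (s - (m₁ - m₂) ^ 2) / (4 * s)
      - (K - 2 * τ * p + τ ^ 2 * P2 - (p - τ * P2) ^ 2 / W ^ 2)
      = ((s + δ + 2 * p) ^ 2 - 4 * W ^ 2 * (K + m₁ ^ 2)) / (4 * W ^ 2) := by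
    rw [hτ, hP2, hδ]
    field_simp
    ring
  have : 0 < ((s + δ + 2 * p) ^ 2 - 4 * W ^ 2 * (K + m₁ ^ 2)) / (4 * W ^ 2) := by positivity
  linarith

/-- The linear map `y ↦ y - c ⟨P, y⟩ P`, contracting the direction of `P`. -/
def contraction (P : Space 3) (c : ℝ) : Space 3 →ₗ[ℝ] Space 3 :=
  LinearMap.transvection (innerₗ (Space 3) P) (-c • P)

theorem contraction_apply (P : Space 3) (c : ℝ) (y : Space 3) :
    contraction P c y = y - (c * inner ℝ P y) • P := by
  simp [contraction, LinearMap.transvection.apply, smul_smul, sub_eq_add_neg, mul_comm]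

theorem det_contraction (P : Space 3) (c : ℝ) :
    LinearMap.det (contraction P c) = 1 - c * ‖P‖ ^ 2 := by
  rw [contraction, LinearMap.transvection.det]
  rw [innerₗ_apply_apply, inner_smul_right, real_inner_self_eq_norm_sq]
  ring

theorem norm_contraction_sq (P : Space 3) (c : ℝ) (y : Space 3) :
    ‖contraction P c y‖ ^ 2
      = ‖y‖ ^ 2 + (c ^ 2 * ‖P‖ ^ 2 - 2 * c) * inner ℝ P y ^ 2 := by
  rw [contraction_apply, norm_sub_sq_real, norm_smul, inner_smul_right, Real.norm_eq_abs, mul_pow,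
    sq_abs, real_inner_comm]
  ring

theorem volume_ball_three {R : ℝ} (hR : 0 ≤ R) :
    volume (Metric.ball (0 : Space 3) R) = ENNReal.ofReal (R ^ 3 * unitBallVolume 3) := by
  rw [Measure.addHaar_ball volume _ hR, finrank_euclideanSpace_fin,
    ENNReal.ofReal_mul (by positivity), unitBallVolume, ofReal_measureReal
      (measure_ball_lt_top.ne)]

/-- The determinants are `1 - c |P|²` for the contraction and `(2π)³` for the frequency scaling;
translation and reflection preserve volume. -/
theorem volume_preimage_affine_ball (P b : Space 3) {c R : ℝ} (hc : 0 < 1 - c * ‖P‖ ^ 2)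
    (hR : 0 ≤ R) :
    volume {ξ : Space 3 | ‖contraction P c (b - (2 * Real.pi) • ξ)‖ < R}
      = ENNReal.ofReal (unitBallVolume 3 / (2 * Real.pi) ^ 3 * (R ^ 3 / (1 - c * ‖P‖ ^ 2))) := by
  have hset : {ξ : Space 3 | ‖contraction P c (b - (2 * Real.pi) • ξ)‖ < R}
      = ((2 * Real.pi) • ·) ⁻¹' ((b - ·) ⁻¹' (contraction P c ⁻¹' Metric.ball 0 R)) := by
    ext ξ
    simp
  have hdet : LinearMap.det (contraction P c) ≠ 0 := by
    rw [det_contraction]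
    exact hc.ne'
  have hmeas : MeasurableSet (contraction P c ⁻¹' Metric.ball 0 R) :=
    (LinearMap.continuous_of_finiteDimensional (contraction P c)).measurable measurableSet_ball
  rw [hset, Measure.addHaar_preimage_smul volume (by positivity),
    (Measure.measurePreserving_sub_left volume b).measure_preimage hmeas.nullMeasurableSet,
    Measure.addHaar_preimage_linearMap volume hdet, volume_ball_three hR, det_contraction,
    finrank_euclideanSpace_fin, abs_of_pos (by positivity), abs_of_pos (by positivity),
    ← ENNReal.ofReal_mul (by positivity), ← ENNReal.ofReal_mul (by positivity)]
  congr 1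
  field_simp

theorem unitBallVolume_nonneg (d : ℕ) : 0 ≤ unitBallVolume d := measureReal_nonneg

/-- The volume of the sublevel sets of the pair symbol. -/
theorem volume_pairSymbol_lt_le (P : Space 3) {mp mm : ℝ} (hmp : 0 < mp) (hmm : 0 < mm) {E : ℝ}
    (hE : 0 < E) :
    volume {ξ : Space 3 | pairSymbol P mp mm ((2 * Real.pi) • ξ) < E}
      ≤ ENNReal.ofReal (unitBallVolume 3 / (2 * Real.pi) ^ 3 * (1 / 8 * (√E ^ 3 *
        volumeFactor (√(‖P‖ ^ 2 + (mp + mm) ^ 2)) (mp + mm) ((mm - mp) ^ 2) E))) := by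
  have hM : 0 < mp + mm := by positivity
  have hg : 0 < √(‖P‖ ^ 2 + (mp + mm) ^ 2) := Real.sqrt_pos.mpr (by positivity)
  have hg2 : √(‖P‖ ^ 2 + (mp + mm) ^ 2) ^ 2 = ‖P‖ ^ 2 + (mp + mm) ^ 2 :=
    Real.sq_sqrt (by positivity)
  set g := √(‖P‖ ^ 2 + (mp + mm) ^ 2) with hgdef
  have hs := invariantMassSq_pos (g := g) (M := mp + mm) hg hM hE.le
  have hsM := le_invariantMassSq (g := g) (M := mp + mm) hg hE.le
  have hsE : invariantMassSq g (mp + mm) E - (mp + mm) ^ 2 = E * (E + 2 * g) := by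
    unfold invariantMassSq; ring
  have hsW : invariantMassSq g (mp + mm) E = (E + g) ^ 2 - ‖P‖ ^ 2 := by
    unfold invariantMassSq
    linear_combination -hg2
  rw [volumeFactor]
  set s := invariantMassSq g (mp + mm) E
  have hW : 0 < E + g := by positivity
  set W := E + g with hWdef
  -- Chosen so that the squared norm of the contracted vector is `|y|² - ⟨P, y⟩²/W²`. The
  -- determinant is then `√s / W`, the inverse Lorentz factor of the boost to the centre-of-mass
  -- frame.
  set c := 1 / (W * (W + √s)) with hc
  have hss := Real.sqrt_pos.mpr hs
  have hs2 := Real.sq_sqrt hs.le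
  have hPs : ‖P‖ ^ 2 = W ^ 2 - √s ^ 2 := by rw [hs2, hsW]; ring
  have hc1 : 1 - c * ‖P‖ ^ 2 = √s / W := by
    rw [hc, hPs]
    field_simp
    ring
  have hc2 : c ^ 2 * ‖P‖ ^ 2 - 2 * c = -(1 / W ^ 2) := by
    rw [hc, hPs]
    field_simp
    ring
  set δ := mp ^ 2 - mm ^ 2 with hδ
  set τ := (s + δ) / (2 * s) with hτ
  have hq : 0 < s - (mm - mp) ^ 2 := by nlinarith
  -- The centre-of-mass momentum of two particles of masses `mp`, `mm` with squared invariant mass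
  -- `s`.
  set R := √E * √(E + 2 * g) * √((s - (mm - mp) ^ 2) / s) / 2 with hRdef
  have hR0 : 0 ≤ R := by positivity
  have hR2 : R ^ 2 = (s - (mp + mm) ^ 2) * (s - (mp - mm) ^ 2) / (4 * s) := by
    rw [hRdef, div_pow, mul_pow, mul_pow, Real.sq_sqrt hE.le, Real.sq_sqrt (by positivity),
      Real.sq_sqrt (by positivity), hsE]
    field_simp
    ring
  calc _ ≤ volume {ξ : Space 3 |
        ‖contraction P c (((mp / (mp + mm)) • P - τ • P) - (2 * Real.pi) • ξ)‖ < R} := by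
        apply measure_mono
        intro ξ hξ
        rw [Set.mem_ofPred_eq] at hξ ⊢
        -- The two particles have momenta `k` and `P - k`, and their total energy is below `W = E +
        -- g`.
        set k := (mp / (mp + mm)) • P - (2 * Real.pi) • ξ with hk
        have hk' : (mm / (mp + mm)) • P + (2 * Real.pi) • ξ = P - k := by
          have : P = (mp / (mp + mm)) • P + (mm / (mp + mm)) • P := by
            rw [← add_smul, ← add_div, div_self hM.ne', one_smul]
          nth_rewrite 2 [this]
          rw [hk]
          abel
        have e1 : mp / (mp + mm) * (mp + mm) = mp := by field_simp
        have e2 : mm / (mp + mm) * (mp + mm) = mm := by field_simp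
        simp only [pairSymbol, ← mul_pow, e1, e2] at hξ
        rw [hk', ← hk, ← hgdef, norm_sub_sq_real P k] at hξ
        have hy : ((mp / (mp + mm)) • P - τ • P) - (2 * Real.pi) • ξ = k - τ • P := by
          rw [hk]; abel
        rw [hy]
        have hb := boosted_norm_sq_lt (K := ‖k‖ ^ 2) (p := inner ℝ P k) (P2 := ‖P‖ ^ 2)
          (m₁ := mp) (m₂ := mm) hW hs hsW hδ hτ (by linarith) (by positivity)
          (by rw [← norm_sub_sq_real]; positivity)
        rw [← hR2] at hb
        refine lt_of_pow_lt_pow_left₀ 2 hR0 (lt_of_eq_of_lt ?_ hb)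
        rw [norm_contraction_sq, hc2, norm_sub_sq_real, norm_smul, inner_smul_right, inner_sub_right,
          inner_smul_right, real_inner_self_eq_norm_sq, Real.norm_eq_abs, mul_pow, sq_abs,
          real_inner_comm]
        ring
    _ = _ := by
        rw [volume_preimage_affine_ball P _ (by rw [hc1]; positivity) hR0, hc1]
        congr 2
        rw [hRdef]
        field_simp
        norm_num

/-- This splitting of `1/t` is the layer cake formula before integration over the momenta; Tonelli's
theorem then brings in the sublevel volumes. -/
theorem lintegral_Ioo_inv_sq {t u : ℝ} (ht : 0 < t) (htu : t < u) :
    ENNReal.ofReal (1 / u) + ∫⁻ E in Set.Ioo t u, ENNReal.ofReal (1 / E ^ 2)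
      = (ENNReal.ofReal t)⁻¹ := by
  have hu : 0 < u := ht.trans htu
  have hne : ∀ E ∈ Set.uIcc t u, E ≠ 0 := fun E hE => by
    rw [Set.uIcc_of_le htu.le] at hE
    exact (ht.trans_le hE.1).ne'
  have hcont : ContinuousOn (fun E : ℝ => 1 / E ^ 2) (Set.uIcc t u) :=
    continuousOn_const.div (by fun_prop) fun E hE => pow_ne_zero 2 (hne E hE)
  have hint := hcont.intervalIntegrable (μ := volume)
  have hval : ∫ E in t..u, 1 / E ^ 2 = 1 / t - 1 / u := by
    rw [intervalIntegral.integral_eq_sub_of_hasDerivAt (f := fun E => -E⁻¹) _ hint]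
    · simp only [one_div]; ring
    · intro E hE
      exact (hasDerivAt_inv (hne E hE)).neg.congr_deriv (by simp)
  rw [intervalIntegrable_iff_integrableOn_Ioc_of_le htu.le] at hint
  rw [← ofReal_integral_eq_lintegral_ofReal (hint.mono_set Set.Ioo_subset_Ioc_self)
    (Filter.Eventually.of_forall fun E => by simp only [Pi.zero_apply]; positivity),
    ← integral_Ioc_eq_integral_Ioo, ← intervalIntegral.integral_of_le htu.le, hval,
    ← ENNReal.ofReal_add (by positivity)
      (by rw [sub_nonneg]; exact one_div_le_one_div_of_le ht htu.le),
    ← ENNReal.ofReal_inv_of_pos ht]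
  congr 1
  rw [add_sub_cancel, one_div]

/-- The layer cake representation of `∫ 1/τ` over a sublevel set of `τ`. -/
theorem lintegral_inv_sublevel_le {τ : Space d → ℝ} (hτm : Measurable τ)
    (hτ0 : ∀ᵐ ξ, 0 < τ ξ) (u : ℝ) :
    ∫⁻ ξ in {ξ | τ ξ < u}, (ENNReal.ofReal (τ ξ))⁻¹
      ≤ ENNReal.ofReal (1 / u) * volume {ξ | τ ξ < u}
        + ∫⁻ E in Set.Ioo 0 u, ENNReal.ofReal (1 / E ^ 2) * volume {ξ | τ ξ < E} := by
  have hR : ∀ u, MeasurableSet {ξ | τ ξ < u} := fun u => measurableSet_lt hτm measurable_const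
  set f : Space d → ℝ → ℝ≥0∞ := fun ξ E => ENNReal.ofReal (1 / E ^ 2) *
    {z : Space d × ℝ | τ z.1 < z.2}.indicator 1 (ξ, E) with hf
  have hfm : Measurable (Function.uncurry f) := by
    have : MeasurableSet {z : Space d × ℝ | τ z.1 < z.2} :=
      measurableSet_lt (hτm.comp measurable_fst) measurable_snd
    refine Measurable.mul (by fun_prop) ?_
    exact measurable_one.indicator this
  calc _ ≤ ∫⁻ ξ in {ξ | τ ξ < u}, (ENNReal.ofReal (1 / u) + ∫⁻ E in Set.Ioo 0 u, f ξ E) := by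
        apply lintegral_mono_ae
        filter_upwards [ae_restrict_of_ae hτ0, ae_restrict_mem (hR u)] with ξ h0 hu
        rw [← lintegral_Ioo_inv_sq h0 hu]
        refine add_le_add le_rfl ?_
        calc _ = ∫⁻ E in Set.Ioo (τ ξ) u, f ξ E := by
              refine setLIntegral_congr_fun measurableSet_Ioo fun E hE => ?_
              simp only [hf]
              rw [Set.indicator_of_mem (show (ξ, E) ∈ {z : Space d × ℝ | τ z.1 < z.2} from hE.1)]
              simp
          _ ≤ _ := lintegral_mono_set (Set.Ioo_subset_Ioo_left h0.le)
    _ = ENNReal.ofReal (1 / u) * volume {ξ | τ ξ < u}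
        + ∫⁻ E in Set.Ioo 0 u, ∫⁻ ξ in {ξ | τ ξ < u}, f ξ E := by
        rw [lintegral_add_left measurable_const, setLIntegral_const,
          lintegral_lintegral_swap hfm.aemeasurable]
    _ ≤ _ := by
        gcongr with E
        calc _ ≤ ∫⁻ ξ, f ξ E := setLIntegral_le_lintegral _ _
          _ = ENNReal.ofReal (1 / E ^ 2) * ∫⁻ ξ, {ξ | τ ξ < E}.indicator 1 ξ := by
              rw [← lintegral_const_mul' _ _ ENNReal.ofReal_ne_top]
              rfl
          _ = _ := by rw [lintegral_indicator_one (hR E)]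

/-- The set where the symbol is nonpositive lies in every sublevel set, and the bound on their
volumes tends to `0` as `E ↓ 0`. -/
theorem pairSymbol_pos_ae (P : Space 3) {mp mm : ℝ} (hmp : 0 < mp) (hmm : 0 < mm) :
    ∀ᵐ ξ : Space 3, 0 < pairSymbol P mp mm ((2 * Real.pi) • ξ) := by
  have hM : 0 < mp + mm := by positivity
  have hg : 0 < √(‖P‖ ^ 2 + (mp + mm) ^ 2) := Real.sqrt_pos.mpr (by positivity)
  rw [ae_iff]
  set F : ℝ → ℝ := fun E => unitBallVolume 3 / (2 * Real.pi) ^ 3 * (1 / 8 * (√E ^ 3 *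
        volumeFactor (√(‖P‖ ^ 2 + (mp + mm) ^ 2)) (mp + mm) ((mm - mp) ^ 2) E)) with hF
  have hFc : ContinuousOn F (Set.Ici 0) := by
    have := continuousOn_volumeFactor (q := (mm - mp) ^ 2) hg hM
    fun_prop
  have hlim : Filter.Tendsto (fun E => ENNReal.ofReal (F E)) (nhdsWithin 0 (Set.Ioi 0))
      (nhds 0) := by
    have h := ((hFc 0 Set.self_mem_Ici).mono Set.Ioi_subset_Ici_self).tendsto
    have h2 := ENNReal.tendsto_ofReal h
    simpa [hF] using h2
  refine le_antisymm (ge_of_tendsto hlim ?_) zero_le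
  filter_upwards [self_mem_nhdsWithin] with E hE
  refine le_trans (measure_mono fun ξ hξ => ?_) (volume_pairSymbol_lt_le P hmp hmm hE)
  exact lt_of_le_of_lt (not_lt.mp hξ) hE

theorem semiclassicalG_eq (P : Space 3) {mp mm u : ℝ} (hmp : 0 < mp) (hmm : 0 < mm)
    (hu : 0 ≤ u) :
    semiclassicalG P (mp + mm) ((mm / (mp + mm) - mp / (mp + mm)) / 2) u
      = unitBallVolume 3 / (2 * Real.pi) ^ 3 * (3 / 8 * (√u ^ 3 *
        volumeFactor (√(‖P‖ ^ 2 + (mp + mm) ^ 2)) (mp + mm) ((mm - mp) ^ 2) u)) := by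
  have hM : 0 < mp + mm := by positivity
  have hg : 0 < √(‖P‖ ^ 2 + (mp + mm) ^ 2) := Real.sqrt_pos.mpr (by positivity)
  have hs := invariantMassSq_pos (M := mp + mm) hg hM hu
  have hsM := le_invariantMassSq (M := mp + mm) hg hu
  have hq : (mm - mp) ^ 2 ≤ (mp + mm) ^ 2 := by nlinarith
  have e : ∀ x : ℝ, 0 ≤ x → x ^ (((3 : ℕ) : ℝ) / 2) = √x ^ 3 := fun x hx => by
    rw [Real.rpow_div_two_eq_sqrt _ hx, Real.rpow_natCast]
  have e4 : (1 - 4 * ((mm / (mp + mm) - mp / (mp + mm)) / 2) ^ 2) * (mp + mm) ^ 2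
      = (mp + mm) ^ 2 - (mm - mp) ^ 2 := by
    field_simp
    ring
  have e5 : u ^ 2 + 2 * u * √(‖P‖ ^ 2 + (mp + mm) ^ 2) + ((mp + mm) ^ 2 - (mm - mp) ^ 2)
      = invariantMassSq (√(‖P‖ ^ 2 + (mp + mm) ^ 2)) (mp + mm) u - (mm - mp) ^ 2 := by
    rw [invariantMassSq]; ring
  simp only [semiclassicalG]
  rw [e4, e5, ← invariantMassSq, e u hu, e _ (by positivity),
    e _ (div_nonneg (by linarith) hs.le), volumeFactor]
  have : (4 * Real.pi) ^ 3 = 8 * (2 * Real.pi) ^ 3 := by ring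
  rw [this]
  field_simp

/-- The boundary term of the layer cake has coefficient `1/8` and the one-dimensional integral
contributes `1/4`. Together they give the `3/8` of the semiclassical term; the rest is the
logarithm. -/
theorem lintegral_inv_pairSymbol_le (P : Space 3) {mp mm u : ℝ} (hmp : 0 < mp) (hmm : 0 < mm)
    (hu : 0 < u) :
    ∫⁻ ξ in {ξ : Space 3 | pairSymbol P mp mm ((2 * Real.pi) • ξ) < u},
      (ENNReal.ofReal (pairSymbol P mp mm ((2 * Real.pi) • ξ)))⁻¹
      ≤ ENNReal.ofReal (modifiedG P (mp + mm) ((mm / (mp + mm) - mp / (mp + mm)) / 2) u / u) := by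
  have hM : 0 < mp + mm := by positivity
  have hg : 0 < √(‖P‖ ^ 2 + (mp + mm) ^ 2) := Real.sqrt_pos.mpr (by positivity)
  have hg2 : √(‖P‖ ^ 2 + (mp + mm) ^ 2) ^ 2 = ‖P‖ ^ 2 + (mp + mm) ^ 2 :=
    Real.sq_sqrt (by positivity)
  have hq : (mm - mp) ^ 2 < (mp + mm) ^ 2 := by nlinarith [mul_pos hmp hmm]
  have hτm : Measurable fun ξ : Space 3 => pairSymbol P mp mm ((2 * Real.pi) • ξ) :=
    (measurable_pairSymbol P mp mm).comp (measurable_const_smul _)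
  rw [modifiedG, semiclassicalG_eq P hmp hmm hu.le]
  set g := √(‖P‖ ^ 2 + (mp + mm) ^ 2) with hgdef
  set b := unitBallVolume 3 / (2 * Real.pi) ^ 3 with hb
  have hb0 : 0 ≤ b := div_nonneg (unitBallVolume_nonneg 3) (by positivity)
  set k := volumeFactor g (mp + mm) ((mm - mp) ^ 2) with hk
  have hk0 : ∀ E, 0 ≤ E → 0 ≤ k E := fun E hE => volumeFactor_nonneg hg hE
  have hlog0 : 0 ≤ Real.log (1 + 3 * g ^ 2 / (mp + mm) ^ 2) :=
    Real.log_nonneg (by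
      have : 0 ≤ 3 * g ^ 2 / (mp + mm) ^ 2 := by positivity
      linarith)
  have hloge : 1 + 3 * g ^ 2 / (mp + mm) ^ 2 = 1 + 3 * (‖P‖ ^ 2 / (mp + mm) ^ 2 + 1) := by
    rw [hg2]
    field_simp
  have hlog := log_le_two_mul_log (t := ‖P‖ ^ 2 / (mp + mm) ^ 2) (by positivity)
  rw [← hloge] at hlog
  have hsq : ∀ E : ℝ, 0 < E → √E ^ 3 = E * √E := fun E hE => by
    rw [pow_succ, Real.sq_sqrt hE.le]
  refine (lintegral_inv_sublevel_le hτm (pairSymbol_pos_ae P hmp hmm) u).trans ?_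
  calc _ ≤ ENNReal.ofReal (1 / u) * ENNReal.ofReal (b * (1 / 8 * (√u ^ 3 * k u)))
        + ∫⁻ E in Set.Ioo 0 u, ENNReal.ofReal b * ENNReal.ofReal (1 / 8 * (k E / √E)) := by
        refine add_le_add (mul_le_mul_right (volume_pairSymbol_lt_le P hmp hmm hu) _) ?_
        refine setLIntegral_mono' measurableSet_Ioo fun E hE => ?_
        refine (mul_le_mul_right (volume_pairSymbol_lt_le P hmp hmm hE.1) _).trans (le_of_eq ?_)
        rw [← ENNReal.ofReal_mul (by positivity), ← ENNReal.ofReal_mul hb0]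
        congr 1
        have h1 := Real.sqrt_pos.mpr hE.1
        have h2 := Real.sq_sqrt hE.1.le
        rw [← hgdef, ← hk, ← hb]
        have h3 : E ^ 2 = √E ^ 4 := by rw [show √E ^ 4 = (√E ^ 2) ^ 2 by ring, h2]
        rw [h3]
        field_simp
    _ ≤ ENNReal.ofReal (1 / u) * ENNReal.ofReal (b * (1 / 8 * (√u ^ 3 * k u)))
        + ENNReal.ofReal b * ENNReal.ofReal (1 / 4 * (√u * k u)
          + ‖P‖ ^ 2 / 4 * Real.log (1 + 3 * g ^ 2 / (mp + mm) ^ 2)) := by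
        rw [lintegral_const_mul' _ _ ENNReal.ofReal_ne_top]
        gcongr
        exact lintegral_volumeFactor_le hg hM hg2 (sq_nonneg _) hq hu
    _ ≤ _ := by
        have hku := hk0 u hu.le
        rw [← ENNReal.ofReal_mul (by positivity), ← ENNReal.ofReal_mul hb0,
          ← ENNReal.ofReal_add (by positivity) (by positivity)]
        apply ENNReal.ofReal_le_ofReal
        set Λ := Real.log (√(1 + ‖P‖ ^ 2 / (mp + mm) ^ 2) + √(2 + ‖P‖ ^ 2 / (mp + mm) ^ 2))
        have hsqrt2 : 0 < √(2 : ℝ) := by positivity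
        have h22 : √(2 : ℝ) ≤ 2 := by
          rw [Real.sqrt_le_left (by norm_num)]
          norm_num
        have e1 : (b * (3 / 8 * (√u ^ 3 * k u))
            + u * (unitBallVolume 3 / (√2 * (2 * Real.pi) ^ 3)) * (‖P‖ ^ 2 + (mp + mm) ^ 2) * Λ) / u
            = b * (3 / 8 * (√u * k u)) + b * ((‖P‖ ^ 2 + (mp + mm) ^ 2) * Λ * (1 / √2)) := by
          rw [hsq u hu, hb]
          field_simp
        have e2 : 1 / u * (b * (1 / 8 * (√u ^ 3 * k u))) = b * (1 / 8 * (√u * k u)) := by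
          rw [hsq u hu]
          field_simp
        rw [e1, e2, ← mul_add, ← mul_add]
        apply mul_le_mul_of_nonneg_left _ hb0
        -- There is room to spare: `|P|²/2` is replaced by `(|P|² + M²)/√2`.
        have h3 : ‖P‖ ^ 2 / 4 * Real.log (1 + 3 * g ^ 2 / (mp + mm) ^ 2)
            ≤ (‖P‖ ^ 2 + (mp + mm) ^ 2) * Λ * (1 / √2) := by
          have hΛ : 0 ≤ Λ := by linarith
          calc _ ≤ ‖P‖ ^ 2 / 4 * (2 * Λ) := by gcongr
            _ = ‖P‖ ^ 2 * Λ * (1 / 2) := by ring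
            _ ≤ _ := by
              gcongr
              nlinarith [sq_nonneg (mp + mm)]
        linarith

/-! ## From negative eigenvalues to orthonormal families -/

theorem mem_formSumGraph_of_mem_eigenspace {T V : Space d → ℝ} (hT : Measurable T) {ψ : HSpace d}
    {z : ℂ} (h : ψ ∈ eigenspace (schrodinger T V) z) : (ψ, z • ψ) ∈ formSumGraph T V := by
  obtain ⟨hψ, e⟩ := h
  rw [← schrodinger_graph hT V, ← e]
  exact (schrodinger T V).mem_graph ⟨ψ, hψ⟩

theorem potentialForm_conj (V : Space d → ℝ) (φ ψ : HSpace d) :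
    conj (potentialForm V φ ψ) = potentialForm V ψ φ := by
  rw [potentialForm, potentialForm, ← integral_conj]
  congr 1 with x
  simp only [map_mul, Complex.conj_ofReal, Complex.conj_conj]
  ring

/-- Eigenvectors to different real eigenvalues are orthogonal. -/
theorem inner_eq_zero_of_mem_formSumGraph {T V : Space d → ℝ} {ψ φ : HSpace d} {a b : ℝ}
    (hψ : (ψ, (a : ℂ) • ψ) ∈ formSumGraph T V) (hφ : (φ, (b : ℂ) • φ) ∈ formSumGraph T V)
    (hab : a ≠ b) : inner ℂ ψ φ = 0 := by
  obtain ⟨h1, H1⟩ := hψ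
  obtain ⟨h2, H2⟩ := hφ
  have e1 := congrArg conj (H1 ⟨φ, h2⟩).2
  have e2 := (H2 ⟨ψ, h1⟩).2
  rw [map_add, potentialForm_conj, inner_smul_right, map_mul, inner_conj_symm,
    Complex.conj_ofReal, kineticForm, inner_conj_symm] at e1
  rw [kineticForm, inner_smul_right] at e2
  have e3 : (a : ℂ) * inner ℂ ψ φ = (b : ℂ) * inner ℂ ψ φ := e1.symm.trans e2
  have e4 : ((a : ℂ) - b) * inner ℂ ψ φ = 0 := by rw [sub_mul, e3, sub_self]
  refine (mul_eq_zero.mp e4).resolve_left ?_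
  exact fun h => hab (by exact_mod_cast sub_eq_zero.mp h)

theorem fourier_fourierMultiplier_ae (b : Space d → ℝ) (f : (fourierMultiplier b).domain) :
    (𝓕 (fourierMultiplier b f) : HSpace d) =ᵐ[volume]
      fun ξ => (b ((2 * Real.pi) • ξ) : ℂ) * (𝓕 (f : HSpace d) : HSpace d) ξ := by
  have : (𝓕 (fourierMultiplier b f) : HSpace d)
      = MemLp.toLp _ (mem_multiplierDomain.mp f.2) := FourierTransform.fourier_fourierInv_eq _
  rw [this]
  exact MemLp.coeFn_toLp _

theorem fourierMultiplier_injective {b : Space d → ℝ}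
    (hb : ∀ᵐ ξ : Space d, b ((2 * Real.pi) • ξ) ≠ 0) (f : (fourierMultiplier b).domain)
    (hf : fourierMultiplier b f = 0) : (f : HSpace d) = 0 := by
  have h0 : (𝓕 (0 : HSpace d) : HSpace d) = 0 := (Lp.fourierTransformₗᵢ (Space d) ℂ).map_zero
  have hae := fourier_fourierMultiplier_ae b f
  rw [hf, h0] at hae
  have hF : (𝓕 (f : HSpace d) : HSpace d) = 0 := by
    rw [Lp.eq_zero_iff_ae_eq_zero]
    filter_upwards [hae, hb, Lp.coeFn_zero ℂ 2 (volume : Measure (Space d))] with ξ h1 h2 h3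
    rw [h3] at h1
    exact (mul_eq_zero.mp h1.symm).resolve_left (by exact_mod_cast h2)
  have h := Lp.norm_fourier_eq (f : HSpace d)
  rw [hF, norm_zero] at h
  exact norm_eq_zero.mp h.symm

/-- If the energy form is nonpositive, then the negative part of the potential dominates. -/
theorem one_le_lintegral_negPart {T V : Space d → ℝ} {ψ f : HSpace d}
    (h : (ψ, f) ∈ formSumGraph T V) (hk : ∀ hψ, kineticForm T ⟨ψ, hψ⟩ ⟨ψ, hψ⟩ = 1)
    (hneg : (inner ℂ ψ f).re ≤ 0) :
    1 ≤ ∫⁻ x, ENNReal.ofReal (max 0 (-V x)) * ‖ψ x‖ₑ ^ 2 := by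
  obtain ⟨hψ, H⟩ := h
  obtain ⟨hint, e⟩ := H ⟨ψ, hψ⟩
  have hfun : (fun x => (V x : ℂ) * (conj (ψ x) * ψ x))
      = fun x => ((V x * ‖ψ x‖ ^ 2 : ℝ) : ℂ) := by
    funext x
    rw [← Complex.normSq_eq_conj_mul_self, Complex.normSq_eq_norm_sq]
    push_cast
    ring
  have hkin : kineticForm T ⟨ψ, hψ⟩ ⟨ψ, hψ⟩ + potentialForm V ψ ψ = inner ℂ ψ f := e
  have hint' : Integrable (fun x => ((V x * ‖ψ x‖ ^ 2 : ℝ) : ℂ)) := by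
    rw [← hfun]; exact hint
  have hintR : Integrable (fun x => V x * ‖ψ x‖ ^ 2) :=
    hint'.re.congr (Filter.Eventually.of_forall fun x => Complex.ofReal_re _)
  rw [hk hψ, potentialForm, hfun, integral_complex_ofReal] at hkin
  -- The kinetic energy is normalised to `1`, so the potential energy is at most `-1`.
  have hre : 1 + ∫ x, V x * ‖ψ x‖ ^ 2 ≤ 0 := by
    rw [← hkin] at hneg
    simpa only [Complex.add_re, Complex.one_re, Complex.ofReal_re] using hneg
  have h1 : 1 ≤ ∫ x, max (-(V x * ‖ψ x‖ ^ 2)) 0 := by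
    have h2 : ∫ x, -(V x * ‖ψ x‖ ^ 2) ≤ ∫ x, max (-(V x * ‖ψ x‖ ^ 2)) 0 :=
      integral_mono hintR.neg hintR.neg.pos_part fun x => le_max_left _ _
    rw [integral_neg] at h2
    linarith
  calc (1 : ℝ≥0∞) = ENNReal.ofReal 1 := ENNReal.ofReal_one.symm
    _ ≤ ENNReal.ofReal (∫ x, max (-(V x * ‖ψ x‖ ^ 2)) 0) := ENNReal.ofReal_le_ofReal h1
    _ = ∫⁻ x, ENNReal.ofReal (max (-(V x * ‖ψ x‖ ^ 2)) 0) :=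
        ofReal_integral_eq_lintegral_ofReal hintR.neg.pos_part
          (Filter.Eventually.of_forall fun x => le_max_right _ _)
    _ = _ := by
        congr 1 with x
        rw [← ofReal_norm, ← ENNReal.ofReal_pow (norm_nonneg _),
          ← ENNReal.ofReal_mul (le_max_left _ _), max_mul_of_nonneg _ _ (by positivity), zero_mul,
          neg_mul, max_comm]

/-- The Gram–Schmidt process in the kinetic form on the span of eigenvectors to nonpositive
eigenvalues. -/
theorem exists_orthonormal_kinetic {T V : Space d → ℝ}
    (hT0 : ∀ᵐ ξ : Space d, 0 < T ((2 * Real.pi) • ξ)) {ι : Type*} [Fintype ι] {ψ : ι → HSpace d}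
    (hψ : Orthonormal ℂ ψ) {e : ι → ℝ} (he : ∀ i, e i ≤ 0)
    (hg : ∀ i, (ψ i, (e i : ℂ) • ψ i) ∈ formSumGraph T V) :
    ∃ F φ : Fin (Fintype.card ι) → HSpace d, Orthonormal ℂ F ∧
      (∀ j, F j =ᵐ[volume] fun ξ => ((√(T ((2 * Real.pi) • ξ)) : ℝ) : ℂ) * φ j ξ) ∧
      ∀ j, 1 ≤ ∫⁻ x, ENNReal.ofReal (max 0 (-V x)) * ‖(𝓕⁻ (φ j) : HSpace d) x‖ₑ ^ 2 := by
  have hdom : ∀ i, ψ i ∈ formDomain T := fun i => (hg i).1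
  set L : (ι → ℂ) →ₗ[ℂ] formDomain T :=
    Fintype.linearCombination ℂ (fun i => (⟨ψ i, hdom i⟩ : formDomain T)) with hL
  have hLc : ∀ c, ((L c : formDomain T) : HSpace d) = ∑ i, c i • ψ i := fun c => by
    rw [hL, Fintype.linearCombination_apply, Submodule.coe_sum]
    rfl
  set S : (ι → ℂ) →ₗ[ℂ] HSpace d := (fourierMultiplier fun η => √(T η)).toFun ∘ₗ L with hS
  -- Since `T > 0` almost everywhere, `√T` loses no dimension, so the new family has as many members
  -- as the old one.
  have hSinj : Function.Injective S := by
    rw [← LinearMap.ker_eq_bot, LinearMap.ker_eq_bot']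
    intro c hc
    have h0 : ((L c : formDomain T) : HSpace d) = 0 :=
      fourierMultiplier_injective (hT0.mono fun ξ hξ => (Real.sqrt_pos.mpr hξ).ne') (L c) hc
    rw [hLc] at h0
    funext i
    exact Fintype.linearIndependent_iff.mp hψ.linearIndependent c h0 i
  have hrank : Module.finrank ℂ (LinearMap.range S) = Fintype.card ι := by
    rw [LinearMap.finrank_range_of_inj hSinj, Module.finrank_fintype_fun_eq_card]
  set b := (stdOrthonormalBasis ℂ (LinearMap.range S)).reindex (finCongr hrank) with hb
  choose c hc using fun j => (b j).2
  have hbo : Orthonormal ℂ fun j => ((b j : LinearMap.range S) : HSpace d) :=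
    b.orthonormal.comp_linearIsometry (LinearMap.range S).subtypeₗᵢ
  refine ⟨fun j => 𝓕 ((b j : LinearMap.range S) : HSpace d),
    fun j => 𝓕 ((L (c j) : formDomain T) : HSpace d),
    hbo.comp_linearIsometry (Lp.fourierTransformₗᵢ (Space d) ℂ).toLinearIsometry, fun j => ?_,
    fun j => ?_⟩
  · have h1 : fourierMultiplier (fun η => √(T η)) (L (c j)) = (b j : LinearMap.range S) := hc j
    have h2 := fourier_fourierMultiplier_ae (fun η => √(T η)) (L (c j))
    rw [h1] at h2
    exact h2
  · rw [FourierTransform.fourierInv_fourier_eq]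
    have hmem : (((L (c j) : formDomain T) : HSpace d), ∑ i, c j i • (e i : ℂ) • ψ i)
        ∈ formSumGraph T V := by
      have h := Submodule.sum_mem (formSumGraph T V) (t := Finset.univ)
        fun i _ => Submodule.smul_mem _ (c j i) (hg i)
      convert h using 1
      rw [Prod.ext_iff]
      refine ⟨?_, ?_⟩
      · rw [Prod.fst_sum, hLc]
        rfl
      · rw [Prod.snd_sum]
        rfl
    refine one_le_lintegral_negPart hmem (fun h => ?_) ?_
    · have h1 : fourierMultiplier (fun η => √(T η)) (L (c j)) = (b j : LinearMap.range S) := hc j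
      change inner ℂ (fourierMultiplier (fun η => √(T η)) (L (c j)))
        (fourierMultiplier (fun η => √(T η)) (L (c j))) = 1
      rw [h1, inner_self_eq_norm_sq_to_K, hbo.1 j]
      simp
    -- The eigenvectors are orthonormal in `L²`, so the energy form is diagonal in their
    -- coefficients and a sum of nonpositive terms.
    · have h2 : inner ℂ ((L (c j) : formDomain T) : HSpace d) (∑ i, c j i • (e i : ℂ) • ψ i)
          = ∑ i, conj (c j i) * (c j i * (e i : ℂ)) := by
        rw [hLc]
        simp only [smul_smul]
        rw [hψ.inner_sum]
      rw [h2, Complex.re_sum]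
      refine Finset.sum_nonpos fun i _ => ?_
      rw [← mul_assoc, ← Complex.normSq_eq_conj_mul_self, ← Complex.ofReal_mul, Complex.ofReal_re]
      exact mul_nonpos_of_nonneg_of_nonpos (Complex.normSq_nonneg _) (he i)

/-! ## Counting -/

/-- Eigenspaces may a priori be infinite-dimensional, so multiplicities are tested through finite
numbers below them. An infinite one admits arbitrarily large tests and forces `C = ∞`. -/
theorem sum_enat_le_of_forall_nat {ι : Type*} (s : Finset ι) (a : ι → ℕ∞) (C : ℝ≥0∞)
    (h : ∀ n : ι → ℕ, (∀ i, (n i : ℕ∞) ≤ a i) → ∑ i ∈ s, (n i : ℝ≥0∞) ≤ C) :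
    ∑ i ∈ s, (a i : ℝ≥0∞) ≤ C := by
  classical
  by_cases hfin : ∀ i ∈ s, a i ≠ ⊤
  · have h1 := h (fun i => (a i).toNat) fun i => ENat.natCast_toNat_le_self _
    refine (Finset.sum_congr rfl fun i hi => ?_).trans_le h1
    conv_lhs => rw [← ENat.natCast_toNat (hfin i hi)]
    simp
  · push Not at hfin
    obtain ⟨j, hj, htop⟩ := hfin
    have hC : C = ∞ := by
      refine ENNReal.eq_top_of_forall_nnreal_le fun r => ?_
      obtain ⟨N, hN⟩ := exists_nat_ge r
      have h1 := h (fun i => if i = j then N else 0) fun i => by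
        split_ifs with hij
        · rw [hij, htop]; exact le_top
        · simp
      rw [Finset.sum_eq_single_of_mem j hj fun i _ hij => by simp [hij]] at h1
      simp only [if_true] at h1
      exact le_trans (by exact_mod_cast hN) h1
    rw [hC]
    exact le_top

theorem exists_orthonormal_of_le_rank {H : Type*} [NormedAddCommGroup H] [InnerProductSpace ℂ H]
    (K : Submodule ℂ H) {n : ℕ} (hn : (n : Cardinal) ≤ Module.rank ℂ K) :
    ∃ v : Fin n → H, Orthonormal ℂ v ∧ ∀ i, v i ∈ K := by
  obtain ⟨v, hv⟩ := Module.le_rank_iff.mp hn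
  exact ⟨fun i => ((InnerProductSpace.gramSchmidtNormed ℂ v i : K) : H),
    (InnerProductSpace.gramSchmidtNormed_orthonormal hv).comp_linearIsometry K.subtypeₗᵢ,
    fun i => (InnerProductSpace.gramSchmidtNormed ℂ v i).2⟩

theorem orthonormal_sigma_of_mem_eigenspace {T V : Space d → ℝ} (hT : Measurable T)
    {s : Finset (Set.Iio (0 : ℝ))} {n : Set.Iio (0 : ℝ) → ℕ}
    {v : (E : Set.Iio (0 : ℝ)) → Fin (n E) → HSpace d} (hv : ∀ E, Orthonormal ℂ (v E))
    (hvm : ∀ (E : Set.Iio (0 : ℝ)) i, v E i ∈ eigenspace (schrodinger T V) ((E : ℝ) : ℂ)) :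
    Orthonormal ℂ fun i : (Σ E : s, Fin (n E)) => v i.1 i.2 := by
  refine ⟨fun i => (hv i.1).1 i.2, fun a b hab => ?_⟩
  obtain ⟨E, i⟩ := a
  obtain ⟨E', j⟩ := b
  by_cases hE : E = E'
  · subst hE
    exact (hv E).2 fun hij => hab (congrArg (Sigma.mk E) hij)
  · refine inner_eq_zero_of_mem_formSumGraph (mem_formSumGraph_of_mem_eigenspace hT (hvm E i))
      (mem_formSumGraph_of_mem_eigenspace hT (hvm E' j)) fun h => hE ?_
    exact Subtype.ext (Subtype.ext h)

/-- The number of negative eigenvalues is bounded by any bound on the cardinality of orthonormal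
families of eigenvectors. -/
theorem numNegEigenvalues_le {T V : Space d → ℝ} (hT : Measurable T) {C : ℝ≥0∞}
    (h : ∀ (ι : Type) [Fintype ι] (ψ : ι → HSpace d) (e : ι → ℝ), Orthonormal ℂ ψ →
      (∀ i, e i ≤ 0) → (∀ i, (ψ i, (e i : ℂ) • ψ i) ∈ formSumGraph T V) →
      (Fintype.card ι : ℝ≥0∞) ≤ C) :
    numNegEigenvalues (schrodinger T V) ≤ C := by
  rw [numNegEigenvalues, ENNReal.tsum_eq_iSup_sum]
  refine iSup_le fun s => sum_enat_le_of_forall_nat s _ C fun n hn => ?_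
  choose v hv hvm using fun E : Set.Iio (0 : ℝ) => exists_orthonormal_of_le_rank
    (eigenspace (schrodinger T V) ((E : ℝ) : ℂ)) (Cardinal.natCast_le_toENat.mp (hn E))
  have hcard := h (Σ E : s, Fin (n E)) (fun i => v i.1 i.2)
    (fun i => ((i.1 : Set.Iio (0 : ℝ)) : ℝ)) (orthonormal_sigma_of_mem_eigenspace hT hv hvm)
    (fun i => (i.1 : Set.Iio (0 : ℝ)).2.le)
    (fun i => mem_formSumGraph_of_mem_eigenspace hT (hvm i.1 i.2))
  refine le_trans (le_of_eq ?_) hcard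
  rw [Fintype.card_sigma, Nat.cast_sum]
  simp only [Fintype.card_fin]
  exact (Finset.sum_coe_sort s fun E => (n E : ℝ≥0∞)).symm

end PairOperator

end

/-! ### Proof of the eigenvalue bound -/

open PairOperator in
theorem theorem3p7 (P : PairOperator.Space 3) (mp mm : ℝ) (hmp : 0 < mp) (hmm : 0 < mm)
    (V : PairOperator.Space 3 → ℝ) (hV : AEMeasurable V volume)
    (hVT : PairOperator.RelativelyFormCompact (PairOperator.pairSymbol P mp mm) V)
    (α : ℝ) (hα : 0 < α) (hα' : α < 1 / 4) :
    PairOperator.numNegEigenvalues (PairOperator.pairOperator P mp mm V) ≤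
      ENNReal.ofReal (α ^ 2 / (1 - 4 * α) ^ 2) *
        ∫⁻ x, ENNReal.ofReal
          (PairOperator.modifiedG P (mp + mm) ((mm / (mp + mm) - mp / (mp + mm)) / 2)
            (max 0 (-V x) / α ^ 2)) := by
  set G := modifiedG P (mp + mm) ((mm / (mp + mm) - mp / (mp + mm)) / 2) with hG
  have hTm : Measurable fun ξ : Space 3 => pairSymbol P mp mm ((2 * Real.pi) • ξ) :=
    (measurable_pairSymbol P mp mm).comp (measurable_const_smul _)
  have hfin : ∀ u : ℝ, ∫⁻ ξ in {ξ : Space 3 | pairSymbol P mp mm ((2 * Real.pi) • ξ) < u},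
      (ENNReal.ofReal (pairSymbol P mp mm ((2 * Real.pi) • ξ)))⁻¹ < ∞ := by
    intro u
    refine lt_of_le_of_lt ((lintegral_mono_set fun ξ hξ => ?_).trans
      (lintegral_inv_pairSymbol_le P hmp hmm (u := max u 1) (lt_max_of_lt_right one_pos)))
      ENNReal.ofReal_lt_top
    exact lt_of_lt_of_le hξ (le_max_left u 1)
  -- The shells in Cwikel's argument must be measurable sets, hence a measurable representative of
  -- `V`.
  set w : Space 3 → ℝ := fun x => max 0 (-hV.mk V x) with hw
  have hwm : Measurable w := measurable_const.max hV.measurable_mk.neg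
  have hwV : ∀ᵐ x, w x = max 0 (-V x) := by
    filter_upwards [hV.ae_eq_mk] with x hx
    rw [hw, hx]
  refine numNegEigenvalues_le (measurable_pairSymbol P mp mm) fun ι _ ψ e hψ he hg => ?_
  obtain ⟨F, φ, hF, hφ, h1⟩ := exists_orthonormal_kinetic
    (pairSymbol_pos_ae P hmp hmm) hψ he hg
  have h1' : ∀ j, 1 ≤ ∫⁻ x, ENNReal.ofReal (w x) * ‖(𝓕⁻ (φ j) : HSpace 3) x‖ₑ ^ 2 := fun j => by
    refine (h1 j).trans_eq (lintegral_congr_ae ?_)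
    filter_upwards [hwV] with x hx
    rw [hx]
  have hmain := card_le_phaseSpace hTm (pairSymbol_pos_ae P hmp hmm) hfin hF hφ hwm hα hα' h1'
  rw [Fintype.card_fin] at hmain
  refine hmain.trans ?_
  calc _ ≤ ENNReal.ofReal (1 / (1 - 4 * α) ^ 2) *
        ∫⁻ x, ENNReal.ofReal (α ^ 2) * ENNReal.ofReal (G (max 0 (-V x) / α ^ 2)) := by
        refine mul_le_mul_right (lintegral_mono_ae ?_) _
        filter_upwards [hwV] with x hx
        rw [hx]
        -- Where the negative part vanishes so does the integrand. Elsewhere, with `u = t/α²`, the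
        -- bound `t · G(u)/u` equals `α² G(u)`.
        rcases (le_max_left 0 (-V x)).eq_or_lt with h0 | h0
        · rw [← h0]
          simp
        · set t := max 0 (-V x)
          have hu : 0 < t / α ^ 2 := by positivity
          refine (mul_le_mul_right (lintegral_inv_pairSymbol_le P hmp hmm hu) _).trans
            (le_of_eq ?_)
          rw [← ENNReal.ofReal_mul h0.le, ← ENNReal.ofReal_mul (by positivity)]
          congr 1
          rw [← hG]
          field_simp
    _ = _ := by
        rw [lintegral_const_mul' _ _ ENNReal.ofReal_ne_top, ← mul_assoc,
          ← ENNReal.ofReal_mul (by positivity)]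
        congr 2
        ring
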